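/- **Setting.** Let $V$ be a finite ground set, $f:2^V\to\mathbb R$ a monotone submodular function with $f(\emptyset)\ge 0$, accessible through a value oracle (a query is a set $S\subseteq V$, the answer is $f(S)$), and $k\ge 0$ a cardinality constraint. A stream is a sequence of $n$ updates, one at each time $t=1,\dots,n$; each update inserts or deletes an element of $V$, each element is inserted at most once and deleted at most once, and it is deleted only after it has been inserted. $V_t$ is the set of elements that have been inserted but not deleted by time $t$ (so $V_0=\emptyset$), and $\mathrm{OPT}_t=\max\{f(S): S\subseteq V_t,\ |S|\le k\}$. For $a\in V$, let $t_a^+,t_a^-\in\{1,\dots,n\}\cup\{\infty\}$ be the times at which $a$ is inserted and deleted ($\infty$ if this does not happen in the stream). Before the stream starts, the algorithm is given $V$, $k$, $\varepsilon$, a tolerance $w\in\mathbb N$ and arbitrary predicted times $\hat t_a^+,\hat t_a^-\in\mathbb N\cup\{\infty\}$ for all $a\in V$. The prediction error is $$\eta=\bigl|\{a\in V:\ |\hat t_a^+-t_a^+|>w\ \text{ or }\ |\hat t_a^--t_a^-|>w\}\bigr|,$$ where $|\infty-\infty|=0$ and $|\infty-s|=|s-\infty|=\infty$ for finite $s$.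 The algorithm may first make oracle queries in a preprocessing phase. It then receives the updates one at a time, and after each update it makes further oracle queries and maintains a solution. It is randomized, and the stream and $f$ do not depend on its random choices; it knows neither $\eta$, nor $n$, nor future updates. Costs are measured by the number of oracle queries. **Theorem.** There is a constant $c$ such that for every $\varepsilon>0$ there are a constant $C$ (depending only on $\varepsilon$) and a randomized algorithm for dynamic monotone submodular maximization with predictions such that, for all $V,k,w$, all predictions and all $f$ as above: 1. (preprocessing) the expected number of queries of the preprocessing phase is at most $C\,(|V|+1)\,\log^c(|V|+2)$, i.e. $\tilde O(|V|)$; and, for every stream, of any length $n$, 2. (amortized update time) the expected total number of queries made while the $n$ updates are processed is at most $$n\cdot C\,\bigl(\log(\eta+2)+\log(w+2)+\log(k+2)\bigr)^c,$$ i.e. the amortized update time is $O(\mathrm{poly}(\log\eta,\log w,\log k))$; 3. (approximation) at every time $t=0,1,\dots,n$ the maintained solution $S_t$ always satisfies $S_t\subseteq V_t$ and $|S_t|\le k$, and $$\mathbb E[f(S_t)]\ \ge\ \bigl(\tfrac12-\varepsilon\bigr)\,\mathrm{OPT}_t .$$ -/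

import Mathlib

namespace DynSubmod

/-! ### Set functions -/

/-- Submodularity in diminishing-returns form: the marginal value of `a` does not increase when the
set it is added to grows. -/
def IsSubmodular {V : Type} [DecidableEq V] (f : Finset V → ℝ) : Prop :=
  ∀ S T : Finset V, S ⊆ T → ∀ a, a ∉ T → f (insert a T) - f T ≤ f (insert a S) - f S

/-- The subsets of `W` with at most `k` elements. -/
def feasible {V : Type} (W : Finset V) (k : ℕ) : Finset (Finset V) :=
  W.powerset.filter (fun S => S.card ≤ k)

theorem feasible_nonempty {V : Type} (W : Finset V) (k : ℕ) : (feasible W k).Nonempty :=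
  ⟨∅, by simp [feasible]⟩

/-- The optimum `max {f S : S ⊆ W, |S| ≤ k}`. -/
noncomputable def opt {V : Type} (f : Finset V → ℝ) (W : Finset V) (k : ℕ) : ℝ :=
  (feasible W k).sup' (feasible_nonempty W k) f

/-! ### Randomized procedures with access to a value oracle -/

/-- A randomized adaptive procedure over the ground set `V` that returns an element of `α`. It
either stops with a result, or asks the value oracle for the value of a set and continues depending
on the answer, or draws a uniformly random element of `Fin (n + 1)` and continues depending on it.
Every run makes finitely many queries and draws. -/
inductive Proc (V : Type) (α : Type) : Type
  | done (a : α) : Proc V α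
  | query (S : Finset V) (next : ℝ → Proc V α) : Proc V α
  | draw (n : ℕ) (next : Fin (n + 1) → Proc V α) : Proc V α

namespace Proc

variable {V α β : Type}

/-- Sequential composition. -/
def bind : Proc V α → (α → Proc V β) → Proc V β
  | done a, h => h a
  | query S next, h => query S (fun x => (next x).bind h)
  | draw n next, h => draw n (fun i => (next i).bind h)

/-- The expectation of `g (result)` when the oracle answers according to `f`. -/
noncomputable def expect (f : Finset V → ℝ) (g : α → ℝ) : Proc V α → ℝ
  | done a => g a
  | query S next => (next (f S)).expect f g
  | draw n next => (∑ i : Fin (n + 1), (next i).expect f g) / (n + 1)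

/-- The expected number of oracle queries when the oracle answers according to `f`. -/
noncomputable def expectedQueries (f : Finset V → ℝ) : Proc V α → ℝ
  | done _ => 0
  | query S next => 1 + (next (f S)).expectedQueries f
  | draw n next => (∑ i : Fin (n + 1), (next i).expectedQueries f) / (n + 1)

/-- Every possible result (for every outcome of the random draws) satisfies `P`, when the oracle
answers according to `f`. -/
def Always (f : Finset V → ℝ) (P : α → Prop) : Proc V α → Prop
  | done a => P a
  | query S next => (next (f S)).Always f P
  | draw n next => ∀ i : Fin (n + 1), (next i).Always f P

end Proc

/-! ### Update streams -/

/-- An update of a dynamic set. -/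
inductive Update (V : Type) : Type
  | ins (a : V) : Update V
  | del (a : V) : Update V

/-- The effect of an update on the set of active elements. -/
def Update.apply {V : Type} [DecidableEq V] (W : Finset V) : Update V → Finset V
  | .ins a => insert a W
  | .del a => W.erase a

/-- The set of active elements after a list of updates, starting from the empty set. -/
def active {V : Type} [DecidableEq V] (us : List (Update V)) : Finset V :=
  us.foldl Update.apply ∅

/-- The list `us` is a stream of updates, the update at time `t = 1, …, n` being the entry with
index `t - 1`: each element is inserted at most once and deleted at most once, and it is deleted
only after it has been inserted. -/
def IsStream {V : Type} (us : List (Update V)) : Prop :=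
  us.Nodup ∧ ∀ (i : ℕ) (a : V), us[i]? = some (.del a) → ∃ j < i, us[j]? = some (.ins a)

/-- The time at which the update `u` happens; `⊤` if it never happens. -/
noncomputable def timeOf {V : Type} (us : List (Update V)) (u : Update V) : ℕ∞ :=
  ⨅ (i : ℕ) (_ : us[i]? = some u), ((i + 1 : ℕ) : ℕ∞)

/-! ### Predictions -/

/-- Predicted insertion and deletion times of all elements of the ground set; `⊤` is the prediction
that the update never happens. -/
structure Prediction (V : Type) : Type where
  insTime : V → ℕ∞
  delTime : V → ℕ∞

/-- `|s - t| ≤ w`, where `⊤` is at distance zero from itself and infinitely far from any finite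
time. -/
def Within (w : ℕ) (s t : ℕ∞) : Prop :=
  s ≤ t + w ∧ t ≤ s + w

/-- The prediction error `η`: the number of elements whose actual insertion time or actual deletion
time is not within `w` of the predicted one. -/
noncomputable def predictionError {V : Type} (w : ℕ) (p : Prediction V)
    (us : List (Update V)) : ℕ :=
  {a : V | ¬ (Within w (p.insTime a) (timeOf us (.ins a)) ∧
    Within w (p.delTime a) (timeOf us (.del a)))}.ncard

/-! ### Dynamic algorithms -/

/-- A dynamic algorithm with a preprocessing phase: `pre` is executed before the stream starts,
`step` processes one update, and `sol` reads off the maintained solution. -/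
structure DynAlg (V : Type) : Type 1 where
  State : Type
  pre : Proc V State
  step : State → Update V → Proc V State
  sol : State → Finset V

namespace DynAlg

variable {V : Type}

/-- Process a list of updates, one after the other, from a given state. -/
def process (A : DynAlg V) : A.State → List (Update V) → Proc V A.State
  | s, [] => .done s
  | s, u :: us => (A.step s u).bind (fun s' => A.process s' us)

/-- Preprocessing followed by the processing of a list of updates. -/
def run (A : DynAlg V) (us : List (Update V)) : Proc V A.State :=
  A.pre.bind (fun s => A.process s us)

/-- The expected total number of oracle queries made while the updates are processed (the queries
of the preprocessing phase are not counted). -/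
noncomputable def expectedUpdateQueries (A : DynAlg V) (f : Finset V → ℝ)
    (us : List (Update V)) : ℝ :=
  A.pre.expect f (fun s => (A.process s us).expectedQueries f)

end DynAlg

end DynSubmod

/-!
A solution for one threshold `τ` is built greedily: an element is added if its marginal value is at
least `τ`. If `τ` is slightly below `OPT / (2 k)`, the result `G` has value about `OPT / 2` at least,
either because it is full or because the optimum adds less than `τ` per element to it
(`le_value_of_valid`). Powers of `1 + δ` serve as guesses of `τ`. An element takes part only in the
`O(log k)` guesses that are at most its value and not much smaller than its value divided by `k`
(`guesses`), and the solution for each guess is maintained separately.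

The set for which a solution is built changes afterwards. The basic step `build` extends a partial
solution to a set `W`, leaving over at most about `s` elements of large marginal value. It selects
elements of almost equal marginal value uniformly at random, and only while more than `s` of them
remain. So if a set `A` that does not depend on the random choices misses only a small fraction of `s`
elements of `W`, the value that is lost by restricting the solution to `A` is in expectation a small
fraction of the value that is gained: `potential f lam A` does not decrease (`pass_expect`,
`build_expect`). To process a large set with few queries, the elements are examined once in random
order, and the point at which to stop is found by binary search (`search`).

Partial solutions form a tree over time. An entry of level `l` is computed at each multiple of `2 ^ l`
from the entry of level `l + 1`, with `s` proportional to `2 ^ l`, so that it costs about `2 ^ l`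
queries, and the at most `2 ^ l` updates until its replacement do little harm; at each update a last
step with `s = 0` completes the solution. Such a tree is computed for the predicted updates in the
preprocessing phase. The same argument makes its entries robust to the prediction error: where the
actual set differs from the predicted one in at most `2 ^ l` elements, the entry of level `l` of the
predicted tree replaces the one of the actual tree (`stackLevel`). Actual and predicted sets differ in
at most `η + 2 w + 1` elements (`disc_active_le`), so only levels with `2 ^ l < η + 2 w + 1` are
recomputed during the stream, at an amortized cost that is polylogarithmic in `η`, `w` and `k`
(`budget_le`). All times at which entries are computed, and the sets they are computed for, are
determined by the stream and `f`; hence the number of queries is bounded for every outcome of the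
random draws, and the sets to which the robustness argument is applied are not random.
-/

namespace DynSubmod

/-! ### Reasoning about randomized procedures -/

namespace Proc

variable {V α β γ : Type} {f : Finset V → ℝ}

theorem bind_assoc (P : Proc V α) (h : α → Proc V β) (h' : β → Proc V γ) :
    (P.bind h).bind h' = P.bind fun a => (h a).bind h' := by
  induction P with
  | done a => rfl
  | query S next ih => simp only [bind, ih]
  | draw n next ih => simp only [bind, ih]

theorem bind_done (P : Proc V α) : P.bind done = P := by
  induction P with
  | done a => rfl
  | query S next ih => simp only [bind, ih]
  | draw n next ih => simp only [bind, ih]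

theorem expect_bind (g : β → ℝ) (P : Proc V α) (h : α → Proc V β) :
    (P.bind h).expect f g = P.expect f fun a => (h a).expect f g := by
  induction P with
  | done a => rfl
  | query S next ih => simp only [bind, expect, ih]
  | draw n next ih => simp only [bind, expect, ih]

/-- Monotonicity of the expectation; only results that can occur matter. -/
theorem expect_mono {g g' : α → ℝ} {P : Proc V α} (hP : P.Always f fun a => g a ≤ g' a) :
    P.expect f g ≤ P.expect f g' := by
  induction P with
  | done a => exact hP
  | query S next ih => exact ih _ hP
  | draw n next ih =>
    simp only [expect]
    gcongr with i
    exact ih i (hP i)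

theorem expect_const (c : ℝ) (P : Proc V α) : P.expect f (fun _ => c) = c := by
  induction P with
  | done a => rfl
  | query S next ih => exact ih _
  | draw n next ih =>
    simp only [expect, ih, Finset.sum_const, Finset.card_univ, Fintype.card_fin, nsmul_eq_mul]
    push_cast
    field_simp

theorem always_mono {p q : α → Prop} (hpq : ∀ a, p a → q a) {P : Proc V α} (hP : P.Always f p) :
    P.Always f q := by
  induction P with
  | done a => exact hpq _ hP
  | query S next ih => exact ih _ hP
  | draw n next ih => exact fun i => ih i (hP i)

theorem always_of_forall {p : α → Prop} (hp : ∀ a, p a) {P : Proc V α} : P.Always f p := by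
  induction P with
  | done a => exact hp a
  | query S next ih => exact ih _
  | draw n next ih => exact fun i => ih i

theorem expect_congr {g g' : α → ℝ} {P : Proc V α} (hP : P.Always f fun a => g a = g' a) :
    P.expect f g = P.expect f g' :=
  le_antisymm (expect_mono (always_mono (fun _ h => le_of_eq h) hP))
    (expect_mono (always_mono (fun _ h => ge_of_eq h) hP))

theorem expect_eq_of_always {g : α → ℝ} {c : ℝ} {P : Proc V α}
    (hP : P.Always f fun a => g a = c) : P.expect f g = c :=
  (expect_congr hP).trans (expect_const c P)

/-- `P.Runs f Q c`: when the oracle answers according to `f`, every run of `P` makes at most `c`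
queries and its result satisfies `Q`. -/
def Runs (f : Finset V → ℝ) (Q : α → Prop) : Proc V α → ℕ → Prop
  | done a, _ => Q a
  | query S next, c => 1 ≤ c ∧ (next (f S)).Runs f Q (c - 1)
  | draw _ next, c => ∀ i, (next i).Runs f Q c

theorem Runs.mono {Q Q' : α → Prop} (hQ : ∀ a, Q a → Q' a) {P : Proc V α} {c c' : ℕ}
    (hc : c ≤ c') (h : P.Runs f Q c) : P.Runs f Q' c' := by
  induction P generalizing c c' with
  | done a => exact hQ _ h
  | query S next ih => exact ⟨h.1.trans hc, ih _ (Nat.sub_le_sub_right hc 1) h.2⟩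
  | draw n next ih => exact fun i => ih i hc (h i)

theorem Runs.le {Q : α → Prop} {P : Proc V α} {c c' : ℕ} (h : P.Runs f Q c) (hc : c ≤ c') :
    P.Runs f Q c' :=
  h.mono (fun _ => id) hc

theorem Runs.bind {Q : α → Prop} {Q' : β → Prop} {P : Proc V α} {h : α → Proc V β} {c c' : ℕ}
    (hP : P.Runs f Q c) (hh : ∀ a, Q a → (h a).Runs f Q' c') : (P.bind h).Runs f Q' (c + c') := by
  induction P generalizing c with
  | done a => exact (hh a hP).le (by omega)
  | query S next ih => exact ⟨by have := hP.1; omega, (ih _ hP.2).le (by have := hP.1; omega)⟩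
  | draw n next ih => exact fun i => ih i (hP i)

theorem Runs.always {Q : α → Prop} {P : Proc V α} {c : ℕ} (h : P.Runs f Q c) : P.Always f Q := by
  induction P generalizing c with
  | done a => exact h
  | query S next ih => exact ih _ h.2
  | draw n next ih => exact fun i => ih i (h i)

theorem Runs.expectedQueries_le {Q : α → Prop} {P : Proc V α} {c : ℕ} (h : P.Runs f Q c) :
    P.expectedQueries f ≤ c := by
  induction P generalizing c with
  | done a => simp [expectedQueries]
  | query S next ih =>
    have := ih _ h.2
    simp only [expectedQueries]
    rw [Nat.cast_sub h.1] at this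
    push_cast at this
    linarith
  | draw n next ih =>
    simp only [expectedQueries]
    rw [div_le_iff₀ (by positivity)]
    calc _ ≤ ∑ _i : Fin (n + 1), (c : ℝ) := Finset.sum_le_sum fun i _ => ih i (h i)
      _ = _ := by simp [mul_comm]

theorem le_expect_of_always {g : α → ℝ} {c : ℝ} {P : Proc V α}
    (hP : P.Always f fun a => c ≤ g a) : c ≤ P.expect f g :=
  (expect_const c P).symm.le.trans (expect_mono hP)

theorem expect_add_const (g : α → ℝ) (c : ℝ) (P : Proc V α) :
    P.expect f (fun a => g a + c) = P.expect f g + c := by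
  induction P with
  | done a => rfl
  | query S next ih => exact ih _
  | draw n next ih =>
    simp only [expect, ih, Finset.sum_add_distrib, Finset.sum_const, Finset.card_univ,
      Fintype.card_fin, nsmul_eq_mul]
    push_cast
    field_simp

variable {ι : Type} [DecidableEq ι]

/-- Run the procedures `h i`, for `i` in a list, and store their results in a table. -/
def loop (h : ι → Proc V α) : List ι → (ι → α) → Proc V (ι → α)
  | [], s => done s
  | i :: l, s => (h i).bind fun a => loop h l (Function.update s i a)

theorem loop_expect_of_notMem (h : ι → Proc V α) {l : List ι} {i : ι} (hi : i ∉ l) (F : α → ℝ)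
    (s : ι → α) : (loop h l s).expect f (fun s' => F (s' i)) = F (s i) := by
  induction l generalizing s with
  | nil => rfl
  | cons j l ih =>
    rw [List.mem_cons, not_or] at hi
    simp only [loop, expect_bind, ih hi.2, Function.update_of_ne hi.1]
    exact expect_const _ _

/-- The marginal law of an entry of the table. -/
theorem loop_expect_of_mem (h : ι → Proc V α) {l : List ι} (hl : l.Nodup) {i : ι} (hi : i ∈ l)
    (F : α → ℝ) (s : ι → α) :
    (loop h l s).expect f (fun s' => F (s' i)) = (h i).expect f F := by
  induction l generalizing s with
  | nil => simp at hi
  | cons j l ih =>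
    rw [List.nodup_cons] at hl
    simp only [loop, expect_bind]
    by_cases hij : i = j
    · subst hij
      simp only [loop_expect_of_notMem h hl.1, Function.update_self]
    · have : i ∈ l := by simpa [hij] using hi
      simp only [ih hl.2 this]
      exact expect_const _ _

theorem loop_runs {h : ι → Proc V α} {Q : ι → α → Prop} {c : ι → ℕ} {l : List ι}
    (hh : ∀ i ∈ l, (h i).Runs f (Q i) (c i)) {s : ι → α} (hs : ∀ i ∉ l, Q i (s i)) :
    (loop h l s).Runs f (fun s' => ∀ i, Q i (s' i)) (l.map c).sum := by
  induction l generalizing s with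
  | nil => exact fun i => hs i (by simp)
  | cons j l ih =>
    rw [List.map_cons, List.sum_cons]
    refine (hh j (by simp)).bind fun a ha => ih (fun i hi => hh i (by simp [hi])) fun i hi => ?_
    by_cases hij : i = j
    · subst hij; simpa using ha
    · rw [Function.update_of_ne hij]
      exact hs i (by simp [hij, hi])

/-- Recompute the entries of a sequence with index below a given number, from the highest to the
lowest; each one may depend on those already computed. -/
def descend (h : ℕ → (ℕ → α) → Proc V α) : ℕ → (ℕ → α) → Proc V (ℕ → α)
  | 0, s => done s
  | n + 1, s => (h n s).bind fun a => descend h n (Function.update s n a)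

/-- An invariant of the recomputation: `I n s` is to hold when the entries from `n` on are up to
date. -/
theorem descend_runs {h : ℕ → (ℕ → α) → Proc V α} {I : ℕ → (ℕ → α) → Prop} {c : ℕ → ℕ}
    (hh : ∀ n s, I (n + 1) s →
      (h n s).Runs f (fun a => I n (Function.update s n a)) (c n)) (n : ℕ) {s : ℕ → α}
    (hs : I n s) : (descend h n s).Runs f (I 0) (∑ j ∈ Finset.range n, c j) := by
  induction n generalizing s with
  | zero => exact hs
  | succ n ih =>
    rw [Finset.sum_range_succ, add_comm _ (c n)]
    exact (hh n s hs).bind fun a ha => ih ha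

/-- An invariant in expectation of the recomputation. The sets `old n` and `new n` contain functions
of the `n`-th entry whose expectation is nonnegative before and after this entry is recomputed. A new
entry gets this property from the old one, from the next higher one, or from the data (of type `σ`)
that the recomputation has access to. -/
theorem descend_expect {σ : Type} {h : σ → ℕ → (ℕ → α) → Proc V α} {old new : ℕ → Set (α → ℝ)}
    {base : Set (σ → ℝ)}
    (hh : ∀ n, ∀ g ∈ new n,
      (∃ g' ∈ old n, ∀ a s, g' (s n) ≤ (h a n s).expect f g) ∨
      (∃ g' ∈ new (n + 1), ∀ a s, g' (s (n + 1)) ≤ (h a n s).expect f g) ∨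
      ∃ b ∈ base, ∀ a s, b a ≤ (h a n s).expect f g)
    (n : ℕ) (P : Proc V (σ × (ℕ → α))) (hbase : ∀ b ∈ base, 0 ≤ P.expect f fun a => b a.1)
    (hnew : ∀ m, n ≤ m → ∀ g ∈ new m, 0 ≤ P.expect f fun a => g (a.2 m))
    (hold : ∀ m, m < n → ∀ g ∈ old m, 0 ≤ P.expect f fun a => g (a.2 m)) (m : ℕ) :
    ∀ g ∈ new m, 0 ≤ (P.bind fun a => descend (h a.1) n a.2).expect f fun s => g (s m) := by
  induction n generalizing P with
  | zero =>
    intro g hg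
    rw [expect_bind]
    exact hnew m (Nat.zero_le _) g hg
  | succ n ih =>
    have key := ih (P.bind fun a => (h a.1 n a.2).bind fun x => done (a.1, Function.update a.2 n x))
      ?_ ?_ ?_
    · simpa only [bind_assoc, bind, descend] using key
    · intro b hb
      simpa only [expect_bind, expect, expect_const] using hbase b hb
    · intro m' hm' g hg
      simp only [expect_bind, expect]
      by_cases hmn : m' = n
      · subst hmn
        simp only [Function.update_self]
        rcases hh m' g hg with ⟨g', hg', H⟩ | ⟨g', hg', H⟩ | ⟨b, hb, H⟩
        · exact (hold m' (Nat.lt_succ_self _) g' hg').trans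
            (expect_mono (always_of_forall fun a => H _ _))
        · exact (hnew _ le_rfl g' hg').trans (expect_mono (always_of_forall fun a => H _ _))
        · exact (hbase b hb).trans (expect_mono (always_of_forall fun a => H _ _))
      · simp only [Function.update_of_ne hmn, expect_const]
        exact hnew m' (by omega) g hg
    · intro m' hm' g hg
      simp only [expect_bind, expect, Function.update_of_ne hm'.ne, expect_const]
      exact hold m' (by omega) g hg

end Proc

/-! ### Marginal values and the potential of a partial solution -/

section Marginal

variable {V : Type} [DecidableEq V] {f : Finset V → ℝ}

/-- The marginal value of `x` over `G`. -/
def marginal (f : Finset V → ℝ) (G : Finset V) (x : V) : ℝ := f (insert x G) - f G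

theorem marginal_of_mem {G : Finset V} {x : V} (hx : x ∈ G) : marginal f G x = 0 := by
  simp [marginal, Finset.insert_eq_of_mem hx]

theorem marginal_anti (hf : Monotone f) (hs : IsSubmodular f) {G G' : Finset V} (h : G ⊆ G')
    (x : V) : marginal f G' x ≤ marginal f G x := by
  by_cases hx : x ∈ G'
  · rw [marginal_of_mem hx]
    exact sub_nonneg.2 (hf (Finset.subset_insert _ _))
  · exact hs G G' h x hx

theorem le_add_sum_marginal (hf : Monotone f) (hs : IsSubmodular f) (G O : Finset V) :
    f (G ∪ O) ≤ f G + ∑ x ∈ O, marginal f G x := by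
  induction O using Finset.induction_on with
  | empty => simp
  | insert a O ha ih =>
    rw [Finset.sum_insert ha, Finset.union_insert]
    have := marginal_anti hf hs (Finset.subset_union_left (s₁ := G) (s₂ := O)) a
    simp only [marginal] at *
    linarith

/-- How much of the value of `G` survives the restriction to `A`, compared with the proportion
`1 - lam` that is aimed at. -/
def potential (f : Finset V → ℝ) (lam : ℝ) (A G : Finset V) : ℝ :=
  f (G ∩ A) - f ∅ - (1 - lam) * (f G - f ∅)

theorem potential_empty (lam : ℝ) (A : Finset V) : potential f lam A ∅ = 0 := by
  simp [potential]

/-- An element of `A` that is added to `G` increases the potential by at least `lam` times its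
marginal value, and an element outside of `A` costs its marginal value. -/
theorem potential_insert (hs : IsSubmodular f) (lam : ℝ) (A : Finset V) {G : Finset V} {x : V}
    (hx : x ∉ G) :
    potential f lam A G + (lam * marginal f G x - if x ∈ A then 0 else marginal f G x) ≤
      potential f lam A (insert x G) := by
  split_ifs with hA
  · have := hs (G ∩ A) G Finset.inter_subset_left x hx
    simp only [potential, marginal, Finset.insert_inter_of_mem hA]
    linarith
  · simp only [potential, marginal, Finset.insert_inter_of_notMem hA]
    linarith

end Marginal

/-! ### Threshold selection in random order -/

section Sift

variable {V α : Type} {f : Finset V → ℝ}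

open Proc

/-- Continue with a uniformly random element of `U`. -/
noncomputable def drawFrom {n : ℕ} (U : Finset V) (h : U.card = n + 1) (next : V → Proc V α) :
    Proc V α :=
  draw n fun i => next ((U.equivFinOfCardEq h).symm i)

theorem drawFrom_expect {n : ℕ} (U : Finset V) (h : U.card = n + 1) (next : V → Proc V α)
    (g : α → ℝ) :
    (drawFrom U h next).expect f g = (∑ x ∈ U, (next x).expect f g) / (n + 1) := by
  rw [drawFrom, expect, Equiv.sum_comp (U.equivFinOfCardEq h).symm
    fun x : U => (next x).expect f g, Finset.sum_coe_sort U fun x => (next x).expect f g]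

open Classical in
/-- The first entry of a nonempty list, given by its head and its tail, that satisfies `p`; the last
entry if there is none. -/
noncomputable def pick (p : Finset V → Prop) : Finset V → List (Finset V) → Finset V
  | G, [] => G
  | G, H :: l => if p G then G else pick p H l

theorem pick_of_pos {p : Finset V → Prop} {G : Finset V} (h : p G) (l : List (Finset V)) :
    pick p G l = G := by
  cases l <;> simp [pick, h]

variable [DecidableEq V]

/-- Ask for the values of all sets in a list. -/
def evalOn : List (Finset V) → Proc V (Finset V → ℝ)
  | [] => done fun _ => 0
  | S :: L => query S fun y => (evalOn L).bind fun v => done (Function.update v S y)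

theorem evalOn_runs (L : List (Finset V)) :
    (evalOn L).Runs f (fun v => ∀ S ∈ L, v S = f S) L.length := by
  induction L with
  | nil => simp [evalOn, Runs]
  | cons S L ih =>
    refine ⟨by simp, ?_⟩
    rw [List.length_cons, Nat.add_sub_cancel]
    refine (ih.bind (c' := 0) fun v hv => ?_).le le_rfl
    intro T hT
    by_cases h : T = S
    · subst h; simp
    · rw [Function.update_of_ne h]
      exact hv T (by simpa [h] using hT)

open Classical in
/-- The elements of `C` whose marginal value over `G` satisfies `p`. -/
noncomputable def select (C G : Finset V) (p : ℝ → Prop) : Proc V (Finset V) :=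
  (evalOn (G :: C.toList.map fun x => insert x G)).bind fun v =>
    done (C.filter fun x => p (v (insert x G) - v G))

theorem select_runs (C G : Finset V) (p : ℝ → Prop) :
    (select C G p).Runs f (fun D => ∀ x, x ∈ D ↔ x ∈ C ∧ p (marginal f G x)) (C.card + 1) := by
  classical
  refine ((evalOn_runs _).bind (c' := 0) fun v hv x => ?_).le (by simp)
  rw [Finset.mem_filter]
  refine and_congr_right fun hx => ?_
  rw [hv G (by simp), hv (insert x G) (List.mem_cons_of_mem _ (List.mem_map.2
    ⟨x, Finset.mem_toList.2 hx, rfl⟩)), marginal]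

/-- A greedy pass over `U` in uniformly random order: an element is added to the solution, unless
this has `k` elements already, if its marginal value is at least `θ`. The result is the list of the
successive solutions after `G`; the first argument is the number of elements of `U`. -/
noncomputable def pass (k : ℕ) (θ : ℝ) : ℕ → Finset V → Finset V → Proc V (List (Finset V))
  | 0, _, _ => done []
  | n + 1, U, G =>
    if k ≤ G.card then done []
    else if h : U.card = n + 1 then
      drawFrom U h fun x => query G fun y => query (insert x G) fun z =>
        if θ ≤ z - y then
          (pass k θ n (U.erase x) (insert x G)).bind fun l => done (insert x G :: l)
        else pass k θ n (U.erase x) G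
    else done []

/-- `l` lists the successive solutions, starting from `G`, of a complete greedy pass over `Q`. -/
def IsPass (f : Finset V → ℝ) (k : ℕ) (θ : ℝ) (Q : Finset V) :
    Finset V → List (Finset V) → Prop
  | G, [] => k ≤ G.card ∨ ∀ x ∈ Q, marginal f G x < θ
  | G, H :: l => G.card < k ∧ (∃ x ∈ Q, x ∉ G ∧ H = insert x G ∧ θ ≤ marginal f G x) ∧
      IsPass f k θ Q H l

theorem pass_runs (hf : Monotone f) (hs : IsSubmodular f) {k : ℕ} {θ : ℝ} (hθ : 0 < θ)
    {Q : Finset V} (n : ℕ) {U G : Finset V} (hU : U.card = n) (hUQ : U ⊆ Q)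
    (hQ : ∀ x ∈ Q, x ∉ U → marginal f G x < θ) :
    (pass k θ n U G).Runs f (IsPass f k θ Q G) (2 * n) := by
  induction n generalizing U G with
  | zero =>
    rw [Finset.card_eq_zero] at hU
    subst hU
    exact Or.inr fun x hx => hQ x hx (by simp)
  | succ n ih =>
    rw [pass]
    split_ifs with hk
    · exact Or.inl hk
    · intro i
      set x : V := ((U.equivFinOfCardEq hU).symm i : V) with hx
      have hxU : x ∈ U := ((U.equivFinOfCardEq hU).symm i).2
      have hc : (U.erase x).card = n := by rw [Finset.card_erase_of_mem hxU, hU]; rfl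
      have hsub : U.erase x ⊆ Q := (Finset.erase_subset _ _).trans hUQ
      refine ⟨by omega, by omega, ?_⟩
      change Runs f _ (if θ ≤ marginal f G x then _ else _) _
      split_ifs with hm
      · refine ((ih hc hsub fun y hy hyU => ?_).bind (c' := 0) fun l hl => ?_).le (by omega)
        · by_cases hyx : y = x
          · subst hyx
            rwa [marginal_of_mem (Finset.mem_insert_self _ _)]
          · exact (marginal_anti hf hs (Finset.subset_insert _ _) y).trans_lt
              (hQ y hy fun h => hyU (Finset.mem_erase.2 ⟨hyx, h⟩))
        · refine ⟨by omega, ⟨x, hUQ hxU, fun hxG => ?_, rfl, hm⟩, hl⟩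
          rw [marginal_of_mem hxG] at hm
          linarith
      · refine (ih hc hsub fun y hy hyU => ?_).le (by omega)
        by_cases hyx : y = x
        · subst hyx
          exact not_le.1 hm
        · exact hQ y hy fun h => hyU (Finset.mem_erase.2 ⟨hyx, h⟩)

open Classical in
/-- The number of elements of `Q` with marginal value at least `θ` over `G` is at most `s`. -/
def Few (f : Finset V → ℝ) (Q : Finset V) (θ : ℝ) (s : ℕ) (G : Finset V) : Prop :=
  (Q.filter fun x => θ ≤ marginal f G x).card ≤ s

theorem few_iff {Q : Finset V} {θ : ℝ} {s : ℕ} {G D : Finset V}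
    (hD : ∀ x, x ∈ D ↔ x ∈ Q ∧ θ ≤ marginal f G x) : Few f Q θ s G ↔ D.card ≤ s := by
  rw [Few]
  refine iff_of_eq (congrArg (fun E : Finset V => E.card ≤ s) ?_)
  ext x
  rw [Finset.mem_filter, hD]

theorem Few.mono (hf : Monotone f) (hs : IsSubmodular f) {Q : Finset V} {θ : ℝ} {s : ℕ}
    {G G' : Finset V} (h : G ⊆ G') (hG : Few f Q θ s G) : Few f Q θ s G' := by
  classical
  refine (Finset.card_le_card ?_).trans hG
  exact Finset.monotone_filter_right _ fun x _ hx => hx.trans (marginal_anti hf hs h x)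

/-- As long as more than `s` elements have a marginal value in `[θ, 2θ)`, the next selected element
is uniform among them, so that few elements outside of `A` cost at most the fraction `lam` of the
value that is gained. -/
theorem pass_expect (hf : Monotone f) (hs : IsSubmodular f) {k s : ℕ} {θ lam : ℝ} (hθ : 0 < θ)
    (hlam : 0 ≤ lam) {Q A : Finset V} (hA : 2 * ((Q \ A).card : ℝ) ≤ lam * s) (n : ℕ)
    {U G : Finset V} (hUQ : U ⊆ Q) (hQ : ∀ x ∈ Q, x ∉ U → marginal f G x < θ)
    (hQ2 : ∀ x ∈ Q, marginal f G x < 2 * θ) :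
    potential f lam A G ≤
      (pass k θ n U G).expect f fun l => potential f lam A (pick (Few f Q θ s) G l) := by
  classical
  induction n generalizing U G with
  | zero => exact le_rfl
  | succ n ih =>
    by_cases hfew : Few f Q θ s G
    · simp only [pick_of_pos hfew, expect_const, le_refl]
    rw [pass]
    split_ifs with hk hU
    · exact le_rfl
    · rw [drawFrom_expect, le_div_iff₀ (by positivity)]
      have step : ∀ x ∈ U, potential f lam A G + ((if θ ≤ marginal f G x then lam * θ else 0) -
          if x ∈ A then 0 else 2 * θ) ≤
          expect f (fun l => potential f lam A (pick (Few f Q θ s) G l))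
            (query G fun y => query (insert x G) fun z =>
              if θ ≤ z - y then
                (pass k θ n (U.erase x) (insert x G)).bind fun l => done (insert x G :: l)
              else pass k θ n (U.erase x) G) := by
        intro x hxU
        have hsub : U.erase x ⊆ Q := (Finset.erase_subset _ _).trans hUQ
        have hxQ := hUQ hxU
        change _ ≤ expect f _ (if θ ≤ marginal f G x then _ else _)
        have h2 := hQ2 x hxQ
        split_ifs with hm hxA hxA
        · refine le_trans ?_ ((ih (G := insert x G) hsub ?_ ?_).trans (le_of_eq ?_))
          · have := potential_insert hs lam A (f := f) (G := G) (x := x) fun hxG => by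
              rw [marginal_of_mem hxG] at hm; linarith
            rw [if_pos hxA] at this
            nlinarith
          · intro y hy hyU
            by_cases hyx : y = x
            · subst hyx
              rwa [marginal_of_mem (Finset.mem_insert_self _ _)]
            · exact (marginal_anti hf hs (Finset.subset_insert _ _) y).trans_lt
                (hQ y hy fun h => hyU (Finset.mem_erase.2 ⟨hyx, h⟩))
          · exact fun y hy => (marginal_anti hf hs (Finset.subset_insert _ _) y).trans_lt (hQ2 y hy)
          · simp only [expect_bind, expect, pick, if_neg hfew]
        · refine le_trans ?_ ((ih (G := insert x G) hsub ?_ ?_).trans (le_of_eq ?_))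
          · have := potential_insert hs lam A (f := f) (G := G) (x := x) fun hxG => by
              rw [marginal_of_mem hxG] at hm; linarith
            rw [if_neg hxA] at this
            nlinarith
          · intro y hy hyU
            by_cases hyx : y = x
            · subst hyx
              rwa [marginal_of_mem (Finset.mem_insert_self _ _)]
            · exact (marginal_anti hf hs (Finset.subset_insert _ _) y).trans_lt
                (hQ y hy fun h => hyU (Finset.mem_erase.2 ⟨hyx, h⟩))
          · exact fun y hy => (marginal_anti hf hs (Finset.subset_insert _ _) y).trans_lt (hQ2 y hy)
          · simp only [expect_bind, expect, pick, if_neg hfew]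
        all_goals
          refine le_trans ?_ (ih (G := G) hsub ?_ hQ2)
          · linarith
          · intro y hy hyU
            by_cases hyx : y = x
            · subst hyx
              exact not_le.1 hm
            · exact hQ y hy fun h => hyU (Finset.mem_erase.2 ⟨hyx, h⟩)
      refine le_trans ?_ (Finset.sum_le_sum step)
      have hR : (U.filter fun x => θ ≤ marginal f G x) =
          Q.filter fun x => θ ≤ marginal f G x := by
        ext x
        simp only [Finset.mem_filter]
        refine ⟨fun h => ⟨hUQ h.1, h.2⟩, fun h => ⟨?_, h.2⟩⟩
        by_contra hxU
        exact absurd h.2 (not_le.2 (hQ x h.1 hxU))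
      have hUA : ((U.filter fun x => x ∉ A).card : ℝ) ≤ (Q \ A).card := by
        rw [← Finset.sdiff_eq_filter]
        exact_mod_cast Finset.card_le_card (Finset.sdiff_subset_sdiff hUQ le_rfl)
      have hs' : (s : ℝ) ≤ (Q.filter fun x => θ ≤ marginal f G x).card := by
        exact_mod_cast (not_le.1 hfew).le
      have e1 : (∑ x ∈ U, if θ ≤ marginal f G x then lam * θ else 0) =
          (Q.filter fun x => θ ≤ marginal f G x).card * (lam * θ) := by
        rw [← Finset.sum_filter, hR, Finset.sum_const, nsmul_eq_mul]
      have e2 : (∑ x ∈ U, if x ∈ A then 0 else 2 * θ) =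
          (U.filter fun x => x ∉ A).card * (2 * θ) := by
        rw [← nsmul_eq_mul, ← Finset.sum_const, Finset.sum_filter]
        exact Finset.sum_congr rfl fun x _ => by split_ifs <;> rfl
      rw [Finset.sum_add_distrib, Finset.sum_sub_distrib, Finset.sum_const, nsmul_eq_mul, hU, e1,
        e2]
      have h1 : lam * θ * s ≤
          (Q.filter fun x => θ ≤ marginal f G x).card * (lam * θ) := by
        rw [mul_comm]; gcongr
      have h3 : 2 * ((Q \ A).card : ℝ) * θ ≤ lam * s * θ := by gcongr
      have h4 : ((U.filter fun x => x ∉ A).card : ℝ) * (2 * θ) ≤ (Q \ A).card * (2 * θ) := by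
        gcongr
      push_cast
      linarith
    · exact le_rfl

end Sift

/-! ### Binary search for the point at which to stop -/

section Search

variable {V : Type} {f : Finset V → ℝ}

open Proc

/-- If the entry with index `j` satisfies `p`, then the first such entry is among the first `j + 1`. -/
theorem pick_take {p : Finset V → Prop} {d : Finset V} (j : ℕ) {G : Finset V}
    {l : List (Finset V)} (h : p ((G :: l).getD j d)) : pick p G (l.take j) = pick p G l := by
  induction j generalizing G l with
  | zero => rw [pick_of_pos (by simpa using h), pick_of_pos (by simpa using h)]
  | succ j ih =>
    cases l with
    | nil => rfl
    | cons H l =>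
      simp only [List.take_succ_cons, pick]
      rw [ih (by simpa using h)]

/-- If the entry with index `j` does not satisfy the monotone property `p`, then the first `j + 1`
entries can be dropped. -/
theorem pick_drop {p : Finset V → Prop} {d : Finset V} (j : ℕ) {G : Finset V}
    {l : List (Finset V)} (hl : (G :: l).Pairwise fun A B => p A → p B) (hj : j < l.length)
    (h : ¬ p ((G :: l).getD j d)) : pick p (l.getD j d) (l.drop (j + 1)) = pick p G l := by
  induction j generalizing G l with
  | zero =>
    cases l with
    | nil => simp at hj
    | cons H l => simp [pick, show ¬ p G by simpa using h]
  | succ j ih =>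
    cases l with
    | nil => simp at hj
    | cons H l =>
      rw [List.pairwise_cons] at hl
      have hj' : j < (H :: l).length := by simp only [List.length_cons] at hj ⊢; omega
      have h' : ¬ p ((H :: l).getD j d) := by simpa using h
      have hG : ¬ p G := fun hG => h' (hl.1 _ (by
        rw [List.getD_eq_getElem _ _ hj']; exact List.getElem_mem _) hG)
      rw [show pick p G (H :: l) = pick p H l by simp [pick, hG],
        ← ih hl.2 (by simpa using hj) h']
      simp

/-- `G'` is obtained from `G` by adding elements, up to a cardinality of at most `k`, that increase
the value by at least `θ` each on average. -/
structure Extends (f : Finset V → ℝ) (k : ℕ) (θ : ℝ) (G G' : Finset V) : Prop where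
  subset : G ⊆ G'
  card_le : G'.card ≤ k
  value : f G + θ * G'.card ≤ f G' + θ * G.card

theorem Extends.trans {k : ℕ} {θ : ℝ} {G G' G'' : Finset V} (h : Extends f k θ G G')
    (h' : Extends f k θ G' G'') : Extends f k θ G G'' :=
  ⟨h.subset.trans h'.subset, h'.card_le, by linarith [h.value, h'.value]⟩

theorem Extends.mono {k : ℕ} {θ θ' : ℝ} {G G' : Finset V} (h : Extends f k θ' G G')
    (hθ : θ ≤ θ') : Extends f k θ G G' := by
  refine ⟨h.subset, h.card_le, ?_⟩
  have h1 : (G.card : ℝ) ≤ G'.card := by exact_mod_cast Finset.card_le_card h.subset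
  nlinarith [h.value]

variable [DecidableEq V]

/-- Binary search for the first solution in the list `G :: l` over which at most `s` elements of `Q`
have a marginal value of at least `θ`, with at most as many steps as the first argument says. -/
noncomputable def search (Q : Finset V) (θ : ℝ) (s : ℕ) :
    ℕ → Finset V → List (Finset V) → Proc V (Finset V)
  | 0, G, _ => done G
  | _ + 1, G, [] => done G
  | n + 1, G, H :: l =>
    (select Q ((G :: H :: l).getD (l.length / 2) G) fun y => θ ≤ y).bind fun D =>
      if D.card ≤ s then search Q θ s n G ((H :: l).take (l.length / 2))
      else search Q θ s n ((H :: l).getD (l.length / 2) G) ((H :: l).drop (l.length / 2 + 1))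

theorem search_runs (hf : Monotone f) (hs : IsSubmodular f) (Q : Finset V) (θ : ℝ) (s n : ℕ)
    {G : Finset V} {l : List (Finset V)} (hl : (G :: l).Pairwise (· ⊆ ·))
    (hn : l.length < 2 ^ n) :
    (search Q θ s n G l).Runs f (fun R => R = pick (Few f Q θ s) G l) (n * (Q.card + 1)) := by
  classical
  induction n generalizing G l with
  | zero =>
    obtain rfl : l = [] := by simpa using hn
    rfl
  | succ n ih =>
    cases l with
    | nil => rfl
    | cons H l =>
      have hp : (G :: H :: l).Pairwise fun A B => Few f Q θ s A → Few f Q θ s B :=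
        hl.imp fun h => Few.mono hf hs h
      rw [List.length_cons, pow_succ] at hn
      have hj : l.length / 2 < (H :: l).length := by rw [List.length_cons]; omega
      rw [search]
      refine ((select_runs _ _ _).bind (c' := n * (Q.card + 1)) fun D hD => ?_).le
        (le_of_eq (by ring))
      split_ifs with hc
      · rw [← pick_take (l.length / 2) (d := G) (by rwa [few_iff hD])]
        refine ih (hl.sublist (List.Sublist.cons_cons _ (List.take_sublist _ _))) ?_
        rw [List.length_take]
        omega
      · rw [← pick_drop (l.length / 2) (d := G) hp hj (by rwa [few_iff hD])]
        refine ih (hl.sublist ?_) ?_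
        · rw [List.getD_eq_getElem _ _ hj, ← List.drop_eq_getElem_cons hj]
          exact (List.drop_sublist _ _).cons _
        · rw [List.length_drop, List.length_cons]
          omega

theorem IsPass.length_le {k : ℕ} {θ : ℝ} {Q G : Finset V} {l : List (Finset V)}
    (h : IsPass f k θ Q G l) : l.length ≤ k - G.card := by
  induction l generalizing G with
  | nil => simp
  | cons H l ih =>
    obtain ⟨hk, ⟨x, -, hx, rfl, -⟩, hl⟩ := h
    have := ih hl
    rw [Finset.card_insert_of_notMem hx] at this
    rw [List.length_cons]
    omega

theorem IsPass.pairwise {k : ℕ} {θ : ℝ} {Q G : Finset V} {l : List (Finset V)}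
    (h : IsPass f k θ Q G l) : (G :: l).Pairwise (· ⊆ ·) := by
  induction l generalizing G with
  | nil => simp
  | cons H l ih =>
    obtain ⟨hk, ⟨x, -, hx, rfl, -⟩, hl⟩ := h
    have := ih hl
    refine List.pairwise_cons.2 ⟨fun A hA => (Finset.subset_insert x G).trans ?_, this⟩
    rcases List.mem_cons.1 hA with rfl | hA
    · exact le_rfl
    · exact (List.pairwise_cons.1 this).1 A hA

theorem IsPass.pick_extends {k s : ℕ} {θ : ℝ} {Q G : Finset V} {l : List (Finset V)}
    (h : IsPass f k θ Q G l) (hG : G.card ≤ k) :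
    Extends f k θ G (pick (Few f Q θ s) G l) ∧
      (k ≤ (pick (Few f Q θ s) G l).card ∨ Few f Q θ s (pick (Few f Q θ s) G l)) := by
  classical
  induction l generalizing G with
  | nil =>
    refine ⟨⟨le_rfl, hG, le_rfl⟩, h.imp_right fun h => ?_⟩
    rw [pick, few_iff (D := ∅) fun x => ?_]
    · simp
    · simpa using h x
  | cons H l ih =>
    by_cases hfew : Few f Q θ s G
    · rw [pick_of_pos hfew]
      exact ⟨⟨le_rfl, hG, le_rfl⟩, Or.inr hfew⟩
    · obtain ⟨hk, ⟨x, -, hx, rfl, hm⟩, hl⟩ := h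
      have hc := Finset.card_insert_of_notMem hx
      obtain ⟨h1, h2⟩ := ih hl (by omega)
      simp only [pick, if_neg hfew]
      refine ⟨Extends.trans ⟨Finset.subset_insert _ _, by omega, ?_⟩ h1, h2⟩
      rw [hc]
      simp only [marginal] at hm
      push_cast
      linarith

/-- Select elements of `Q` in random order, as in `pass`, but only until at most `s` elements with a
marginal value of at least `θ` are left. -/
noncomputable def sift (k n s : ℕ) (θ : ℝ) (Q G : Finset V) : Proc V (Finset V) :=
  (pass k θ Q.card Q G).bind (search Q θ s n G)

theorem sift_runs (hf : Monotone f) (hs : IsSubmodular f) {k n : ℕ} (hn : k < 2 ^ n) (s : ℕ)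
    {θ : ℝ} (hθ : 0 < θ) (Q : Finset V) {G : Finset V} (hG : G.card ≤ k) :
    (sift k n s θ Q G).Runs f
      (fun G' => Extends f k θ G G' ∧ (k ≤ G'.card ∨ Few f Q θ s G'))
      ((n + 2) * (Q.card + 1)) := by
  refine ((pass_runs hf hs hθ Q.card rfl le_rfl fun x hx h => absurd hx h).bind fun l hl =>
    (search_runs hf hs Q θ s n hl.pairwise ?_).mono (fun R hR => ?_) le_rfl).le ?_
  · have := hl.length_le
    omega
  · subst hR
    exact hl.pick_extends hG
  · ring_nf; omega

theorem sift_expect (hf : Monotone f) (hs : IsSubmodular f) {k n s : ℕ} (hn : k < 2 ^ n)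
    {θ lam : ℝ} (hθ : 0 < θ) (hlam : 0 ≤ lam) {Q A : Finset V}
    (hA : 2 * ((Q \ A).card : ℝ) ≤ lam * s) {G : Finset V}
    (hQ2 : ∀ x ∈ Q, marginal f G x < 2 * θ) :
    potential f lam A G ≤ (sift k n s θ Q G).expect f (potential f lam A) := by
  refine (pass_expect (k := k) hf hs hθ hlam hA Q.card le_rfl (fun x hx h => absurd hx h) hQ2).trans
    (le_of_eq ?_)
  rw [sift, expect_bind]
  refine expect_congr (always_mono (fun l hl => ?_)
    (pass_runs hf hs hθ Q.card rfl le_rfl fun x hx h => absurd hx h).always)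
  refine (expect_eq_of_always (always_mono (fun R hR => ?_)
    (search_runs hf hs Q θ s n hl.pairwise ?_).always)).symm
  · rw [hR]
  · have := hl.length_le
    omega

/-- Apply `sift` to the elements of `C` with marginal values in `[2 ^ i * τ, 2 ^ (i + 1) * τ)`, for
decreasing `i`. -/
noncomputable def bands (k n s : ℕ) (τ : ℝ) (C : Finset V) : ℕ → Finset V → Proc V (Finset V)
  | 0, G => done G
  | i + 1, G => (select C G fun y => 2 ^ i * τ ≤ y ∧ y < 2 * (2 ^ i * τ)).bind fun Q =>
      (sift k n s (2 ^ i * τ) Q G).bind (bands k n s τ C i)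

/-- The elements with a large marginal value that a band leaves over fall into lower bands later on,
so the numbers of these elements add up. -/
theorem bands_runs (hf : Monotone f) (hs : IsSubmodular f) {k n : ℕ} (hn : k < 2 ^ n) (s : ℕ)
    {τ : ℝ} (hτ : 0 < τ) (C : Finset V) (i r : ℕ) {G : Finset V} (hG : G.card ≤ k)
    (hr : k ≤ G.card ∨ Few f C (2 ^ i * τ) r G) :
    (bands k n s τ C i G).Runs f
      (fun G' => Extends f k τ G G' ∧ (k ≤ G'.card ∨ Few f C τ (r + i * s) G'))
      (i * ((n + 3) * (C.card + 1))) := by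
  classical
  induction i generalizing G r with
  | zero => exact ⟨⟨le_rfl, hG, le_rfl⟩, by simpa using hr⟩
  | succ i ih =>
    have hle : τ ≤ 2 ^ i * τ := le_mul_of_one_le_left hτ.le (one_le_pow₀ (by norm_num))
    refine ((select_runs C G _).bind (c' := (n + 2) * (C.card + 1) + i * ((n + 3) * (C.card + 1)))
      fun Q hQ => ?_).le (le_of_eq (by ring))
    have hQC : Q.card ≤ C.card := Finset.card_le_card fun x hx => ((hQ x).1 hx).1
    refine ((sift_runs hf hs hn s (by linarith) Q hG).le
      (Nat.mul_le_mul_left _ (Nat.succ_le_succ hQC))).bind fun G' hG' => ?_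
    refine (ih (r + s) hG'.1.card_le ?_).mono (fun G'' h => ⟨(hG'.1.mono hle).trans h.1, ?_⟩) le_rfl
    · rcases hG'.2 with hk | hfew
      · exact Or.inl hk
      rcases hr with hk | hr
      · exact Or.inl (hk.trans (Finset.card_le_card hG'.1.subset))
      refine Or.inr (le_trans (Finset.card_le_card ?_)
        ((Finset.card_union_le _ _).trans (Nat.add_le_add hr hfew)))
      intro x hx
      rw [Finset.mem_filter] at hx
      have hx' := hx.2.trans (marginal_anti hf hs hG'.1.subset x)
      rw [Finset.mem_union, Finset.mem_filter, Finset.mem_filter, hQ]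
      by_cases hb : marginal f G x < 2 * (2 ^ i * τ)
      · exact Or.inr ⟨⟨hx.1, hx', hb⟩, hx.2⟩
      · exact Or.inl ⟨hx.1, by rw [pow_succ]; linarith⟩
    · have := h.2
      rwa [add_assoc, show s + i * s = (i + 1) * s by ring] at this

theorem bands_expect (hf : Monotone f) (hs : IsSubmodular f) {k n s : ℕ} (hn : k < 2 ^ n)
    {τ lam : ℝ} (hτ : 0 < τ) (hlam : 0 ≤ lam) {C A : Finset V}
    (hA : 2 * ((C \ A).card : ℝ) ≤ lam * s) (i : ℕ) (G : Finset V) :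
    potential f lam A G ≤ (bands k n s τ C i G).expect f (potential f lam A) := by
  classical
  induction i generalizing G with
  | zero => exact le_rfl
  | succ i ih =>
    rw [bands, expect_bind]
    refine le_expect_of_always (always_mono (fun Q hQ => ?_) (select_runs C G _).always)
    have hQC : (((Q \ A).card : ℕ) : ℝ) ≤ (C \ A).card := by
      exact_mod_cast Finset.card_le_card
        (Finset.sdiff_subset_sdiff (fun x hx => ((hQ x).1 hx).1) le_rfl)
    rw [expect_bind]
    exact (sift_expect hf hs hn (mul_pos (pow_pos two_pos i) hτ) hlam (by linarith)
      fun x hx => ((hQ x).1 hx).2.2).trans (expect_mono (always_of_forall ih))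

end Search

/-! ### Extending a partial solution to a new set -/

section Build

variable {V : Type} [DecidableEq V] {f : Finset V → ℝ}

open Proc

/-- A partial solution `G` for the set `W`, together with the set `R` of those elements of `W` that
may still have a large marginal value over `G`. -/
structure Entry (V : Type) : Type where
  W : Finset V
  G : Finset V
  R : Finset V

/-- The empty solution for the empty set. -/
def Entry.root : Entry V := ⟨∅, ∅, ∅⟩

/-- `G` is a result of a greedy selection with threshold `τ`, and unless it is full, all elements of
`W` with marginal value at least `τ` are in `R`, a set of at most `r` elements. -/
structure Entry.Valid (f : Finset V → ℝ) (k : ℕ) (τ : ℝ) (r : ℕ) (e : Entry V) : Prop where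
  greedy : Extends f k τ ∅ e.G
  full_or : k ≤ e.G.card ∨ ((∀ x ∈ e.W, x ∉ e.R → marginal f e.G x < τ) ∧ e.R.card ≤ r)

theorem Entry.root_valid (k : ℕ) (τ : ℝ) (r : ℕ) : (Entry.root : Entry V).Valid f k τ r :=
  ⟨⟨le_rfl, by simp [root], le_rfl⟩, Or.inr ⟨by simp [root], by simp [root]⟩⟩

/-- Extend the solution of the entry `e` to the set `W`. Among the elements of `e.W`, only those in
`e.R` are considered again. -/
noncomputable def build (k n p : ℕ) (τ : ℝ) (W : Finset V) (s : ℕ) (e : Entry V) :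
    Proc V (Entry V) :=
  if k ≤ e.G.card then done ⟨W, e.G, ∅⟩
  else (bands k n s τ (W.filter fun x => x ∈ e.W → x ∈ e.R) p e.G).bind fun G =>
    (select (W.filter fun x => x ∈ e.W → x ∈ e.R) G fun y => τ ≤ y).bind fun R => done ⟨W, G, R⟩

/-- An entry can be extended to `W` with a number of queries that is about the number of elements of
`W` that are new or left over. -/
theorem build_runs (hf : Monotone f) (hs : IsSubmodular f) {k n p : ℕ} (hn : k < 2 ^ n) {τ : ℝ}
    (hτ : 0 < τ) {W : Finset V} (hW : ∀ x ∈ W, marginal f ∅ x < 2 ^ p * τ) (s : ℕ) {e : Entry V}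
    {r q : ℕ} (he : e.Valid f k τ r) (hq : r + (W \ e.W).card ≤ q) :
    (build k n p τ W s e).Runs f (fun e' => e'.Valid f k τ (p * s) ∧ e'.W = W)
      ((p + 1) * ((n + 3) * (q + 1))) := by
  classical
  rw [build]
  split_ifs with hk
  · exact ⟨⟨he.greedy, Or.inl hk⟩, rfl⟩
  set C := W.filter fun x => x ∈ e.W → x ∈ e.R with hC
  obtain ⟨hR, hr⟩ := he.full_or.resolve_left hk
  have hCq : C.card ≤ q := by
    refine le_trans ?_ hq
    refine (Finset.card_le_card (t := e.R ∪ (W \ e.W)) fun x hx => ?_).trans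
      ((Finset.card_union_le _ _).trans (Nat.add_le_add_right hr _))
    rw [hC, Finset.mem_filter] at hx
    rw [Finset.mem_union, Finset.mem_sdiff]
    by_cases hxe : x ∈ e.W
    · exact Or.inl (hx.2 hxe)
    · exact Or.inr ⟨hx.1, hxe⟩
  -- no element lies above the highest band
  have hfew : Few f C (2 ^ p * τ) 0 e.G := by
    rw [Few, Nat.le_zero, Finset.card_eq_zero]
    exact Finset.filter_false_of_mem fun x hx => not_le.2
      ((marginal_anti hf hs (Finset.empty_subset _) x).trans_lt (hW x (Finset.mem_filter.1 hx).1))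
  refine ((bands_runs hf hs hn s hτ C p 0 he.greedy.card_le (Or.inr hfew)).bind fun G hG =>
    (select_runs C G _).bind (c' := 0) fun R hR' => ?_).le ?_
  · refine ⟨⟨he.greedy.trans hG.1, hG.2.imp_right fun h => ⟨fun x hx hxR => ?_, ?_⟩⟩, rfl⟩
    · by_cases hxC : x ∈ C
      · rw [hR', not_and] at hxR
        exact not_le.1 (hxR hxC)
      · rw [hC, Finset.mem_filter, not_and, Classical.not_imp] at hxC
        exact (marginal_anti hf hs hG.1.subset x).trans_lt (hR x (hxC hx).1 (hxC hx).2)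
    · rw [few_iff hR'] at h
      simpa using h
  · have h1 : (n + 3) * (C.card + 1) ≤ (n + 3) * (q + 1) := by gcongr
    have h2 : C.card + 1 ≤ (n + 3) * (q + 1) := by nlinarith
    calc _ ≤ p * ((n + 3) * (q + 1)) + (n + 3) * (q + 1) := by
          gcongr
      _ = _ := by ring

/-- If `A` misses few elements of `W`, then extending a partial solution to `W` does not decrease its
potential in expectation. -/
theorem build_expect (hf : Monotone f) (hs : IsSubmodular f) {k n p : ℕ} (hn : k < 2 ^ n)
    {τ lam : ℝ} (hτ : 0 < τ) (hlam : 0 ≤ lam) {W A : Finset V} {s : ℕ}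
    (hA : 2 * ((W \ A).card : ℝ) ≤ lam * s) (e : Entry V) :
    potential f lam A e.G ≤
      (build k n p τ W s e).expect f fun e' => potential f lam A e'.G := by
  rw [build]
  split_ifs with hk
  · exact le_rfl
  simp only [expect_bind, expect, expect_const]
  refine bands_expect hf hs hn hτ hlam (le_trans ?_ hA) p e.G
  gcongr
  exact Finset.filter_subset _ _

end Build

/-! ### Active sets of lists of updates -/

section Stream

variable {V : Type}

/-- The element that is inserted or deleted. -/
def Update.elt : Update V → V
  | .ins a => a
  | .del a => a

variable [DecidableEq V]

theorem card_sdiff_le (A B C : Finset V) : (A \ C).card ≤ (A \ B).card + (B \ C).card := by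
  refine (Finset.card_le_card fun x hx => ?_).trans (Finset.card_union_le _ _)
  simp only [Finset.mem_union, Finset.mem_sdiff] at *
  tauto

theorem active_append (us vs : List (Update V)) :
    active (us ++ vs) = vs.foldl Update.apply (active us) :=
  List.foldl_append

theorem card_sdiff_foldl_le (us : List (Update V)) (W : Finset V) :
    (us.foldl Update.apply W \ W).card ≤ us.length ∧
      (W \ us.foldl Update.apply W).card ≤ us.length := by
  induction us generalizing W with
  | nil => simp
  | cons u us ih =>
    have h1 : (u.apply W \ W).card ≤ 1 ∧ (W \ u.apply W).card ≤ 1 := by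
      cases u with
      | ins a =>
        refine ⟨(Finset.card_le_card fun x hx => ?_).trans (Finset.card_singleton a).le,
          (Finset.card_le_card fun x hx => ?_).trans (Finset.card_singleton a).le⟩ <;>
        simp only [Update.apply, Finset.mem_sdiff, Finset.mem_insert, Finset.mem_singleton] at * <;>
        tauto
      | del a =>
        refine ⟨(Finset.card_le_card fun x hx => ?_).trans (Finset.card_singleton a).le,
          (Finset.card_le_card fun x hx => ?_).trans (Finset.card_singleton a).le⟩ <;>
        simp only [Update.apply, Finset.mem_sdiff, Finset.mem_erase, Finset.mem_singleton] at * <;>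
        tauto
    obtain ⟨h2, h3⟩ := ih (u.apply W)
    rw [List.foldl_cons, List.length_cons]
    exact ⟨(card_sdiff_le _ (u.apply W) _).trans (by omega),
      (card_sdiff_le _ (u.apply W) _).trans (by omega)⟩

/-- Each update changes the active set by at most one element. -/
theorem card_sdiff_active_take_le (us : List (Update V)) {i j : ℕ} (h : i ≤ j) :
    (active (us.take j) \ active (us.take i)).card ≤ j - i ∧
      (active (us.take i) \ active (us.take j)).card ≤ j - i := by
  have hj : us.take j = us.take i ++ (us.drop i).take (j - i) := by
    rw [← List.take_add, Nat.add_sub_cancel' h]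
  have := card_sdiff_foldl_le ((us.drop i).take (j - i)) (active (us.take i))
  rw [← active_append, ← hj, List.length_take] at this
  omega

theorem active_filter (U : Finset V) (us : List (Update V)) :
    active (us.filter fun u => u.elt ∈ U) = active us ∩ U := by
  induction us using List.reverseRecOn with
  | nil => simp [active]
  | append_singleton us u ih =>
    rw [List.filter_append, active_append, active_append, ih]
    by_cases hu : u.elt ∈ U
    · cases u <;> simp only [Update.elt] at hu <;>
        simp [Update.elt, hu, Update.apply, Finset.insert_inter_of_mem, Finset.erase_inter]
    · cases u <;> simp only [Update.elt] at hu <;>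
        simp [Update.elt, hu, Update.apply, Finset.insert_inter_of_notMem, Finset.erase_inter]

/-- The size of the symmetric difference. -/
def disc (A W : Finset V) : ℕ := (A \ W).card + (W \ A).card

end Stream

/-! ### The algorithm for a fixed threshold -/

section Guess

variable {V : Type} [DecidableEq V] {f : Finset V → ℝ}

open Proc

/-- The parameters of the algorithm for a fixed threshold `τ`: the cardinality constraint, a number
of steps that suffices for the binary searches, the number of bands of marginal values, the factor
by which levels are larger than the number of updates they have to cope with, and the threshold. -/
structure Params : Type where
  k : ℕ
  n : ℕ
  p : ℕ
  K : ℕ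
  τ : ℝ

/-- The state of the algorithm for a fixed threshold. The entry `pred l j` is computed in the
preprocessing phase, for the set that is predicted to be active after `j * 2 ^ l` predicted updates;
`stack l` belongs to the last time that is a multiple of `2 ^ l`, and `fin` to the present. -/
structure GuessState (V : Type) : Type where
  pred : ℕ → ℕ → Entry V
  stack : ℕ → Entry V
  fin : Entry V

/-- Compute the entries of level `l` for the list `es` of predicted updates. -/
noncomputable def predLevel (P : Params) (es : List (Update V)) (l : ℕ) (t : ℕ → ℕ → Entry V) :
    Proc V (ℕ → Entry V) :=
  loop (fun j => build P.k P.n P.p P.τ (active (es.take (j * 2 ^ l))) (P.K * 2 ^ l)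
    (t (l + 1) (j / 2))) (List.range' 1 (es.length / 2 ^ l)) fun _ => Entry.root

/-- The preprocessing phase. -/
noncomputable def guessPre (P : Params) (es : List (Update V)) : Proc V (GuessState V) :=
  (descend (predLevel P es) es.length.size fun _ _ => Entry.root).bind fun t =>
    done ⟨t, fun _ => Entry.root, Entry.root⟩

/-- The new entry of level `l` of the stack after the updates `us`, where `i` updates should have
happened according to the predictions. When the number of updates is a multiple of `2 ^ l`, the
entry for the predicted set is taken if this set is close enough to the actual one; otherwise, the
entry is computed from the one of the next level. -/
noncomputable def stackLevel (P : Params) (es us : List (Update V)) (i : ℕ)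
    (pred : ℕ → ℕ → Entry V) (l : ℕ) (st : ℕ → Entry V) : Proc V (Entry V) :=
  if 2 ^ l ∣ us.length then
    if disc (active us) (active (es.take i)) ≤ 2 ^ l then done (pred l (i / 2 ^ l))
    else build P.k P.n P.p P.τ (active us) (P.K * 2 ^ l) (st (l + 1))
  else done (st l)

/-- The reaction to the last one of the updates `us`. -/
noncomputable def guessStep (P : Params) (es us : List (Update V)) (i : ℕ) (g : GuessState V) :
    Proc V (GuessState V) :=
  (descend (stackLevel P es us i g.pred) us.length g.stack).bind fun st =>
    (build P.k P.n P.p P.τ (active us) 0 (st 0)).bind fun e => done ⟨g.pred, st, e⟩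

/-- The number of steps of the binary searches suffices, and the bands cover the values of all
elements of `U`. -/
structure Params.Good (P : Params) (f : Finset V → ℝ) (U : Finset V) : Prop where
  fuel : P.k < 2 ^ P.n
  pos : 0 < P.τ
  lt : ∀ x ∈ U, marginal f ∅ x < 2 ^ P.p * P.τ

/-- A computation of an entry of level `l` takes at most `P.cost * 2 ^ l` queries. -/
def Params.cost (P : Params) : ℕ := (P.p + 1) * ((P.n + 3) * (2 * P.p * P.K + 7))

/-- What is always true of the precomputed entries. -/
def PredInv (f : Finset V → ℝ) (P : Params) (es : List (Update V)) (l : ℕ) (t : ℕ → Entry V) :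
    Prop :=
  ∀ j, j * 2 ^ l ≤ es.length →
    (t j).Valid f P.k P.τ (P.p * (P.K * 2 ^ l)) ∧ (t j).W = active (es.take (j * 2 ^ l))

/-- The last multiple of `2 ^ l` up to `n`. -/
def roundDown (l n : ℕ) : ℕ := n / 2 ^ l * 2 ^ l

theorem roundDown_le (l n : ℕ) : roundDown l n ≤ n := Nat.div_mul_le_self _ _

theorem lt_roundDown_add (l n : ℕ) : n < roundDown l n + 2 ^ l := by
  have h := Nat.div_add_mod' n (2 ^ l)
  have h' := Nat.mod_lt n (Nat.two_pow_pos l)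
  rw [roundDown]
  omega

theorem roundDown_of_dvd {l n : ℕ} (h : 2 ^ l ∣ n) : roundDown l n = n := Nat.div_mul_cancel h

theorem roundDown_succ_of_not_dvd {l n : ℕ} (h : ¬ 2 ^ l ∣ n + 1) :
    roundDown l (n + 1) = roundDown l n := by
  rw [roundDown, Nat.succ_div, if_neg h, add_zero, roundDown]

/-- What is always true of an entry of the stack. -/
def StackInv (f : Finset V → ℝ) (P : Params) (us : List (Update V)) (l : ℕ) (e : Entry V) : Prop :=
  e.Valid f P.k P.τ (P.p * (P.K * 2 ^ l)) ∧
    (active (us.take (roundDown l us.length)) \ e.W).card ≤ 2 * 2 ^ l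

/-- What is always true of the state after the updates `us`. -/
structure GuessInv (f : Finset V → ℝ) (P : Params) (es us : List (Update V)) (g : GuessState V) :
    Prop where
  pred : ∀ l, PredInv f P es l (g.pred l)
  stack : ∀ l, StackInv f P us l (g.stack l)
  fin : g.fin.Valid f P.k P.τ 0 ∧ g.fin.W = active us

theorem active_subset {U : Finset V} {us : List (Update V)} (h : ∀ u ∈ us, u.elt ∈ U) :
    active us ⊆ U := by
  have := active_filter U us
  rw [List.filter_eq_self.2 fun u hu => by simpa using h u hu] at this
  rw [this]
  exact Finset.inter_subset_right

theorem level_cost_le (P : Params) {l q : ℕ}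
    (hq : q ≤ P.p * (P.K * 2 ^ (l + 1)) + 6 * 2 ^ l) :
    (P.p + 1) * ((P.n + 3) * (q + 1)) ≤ P.cost * 2 ^ l := by
  have h1 : 1 ≤ 2 ^ l := Nat.one_le_two_pow
  have h2 : q + 1 ≤ (2 * P.p * P.K + 7) * 2 ^ l := by
    rw [pow_succ] at hq
    nlinarith
  calc (P.p + 1) * ((P.n + 3) * (q + 1)) ≤
      (P.p + 1) * ((P.n + 3) * ((2 * P.p * P.K + 7) * 2 ^ l)) := by gcongr
    _ = _ := by rw [Params.cost]; ring

theorem half_mul_two_pow (l j : ℕ) : j / 2 * 2 ^ (l + 1) ≤ j * 2 ^ l ∧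
    j * 2 ^ l ≤ j / 2 * 2 ^ (l + 1) + 2 ^ l := by
  have h1 : 2 * (j / 2) ≤ j := Nat.mul_div_le _ _
  have h2 : j ≤ 2 * (j / 2) + 1 := by omega
  rw [pow_succ]
  constructor
  · calc j / 2 * (2 ^ l * 2) = 2 * (j / 2) * 2 ^ l := by ring
      _ ≤ _ := by gcongr
  · calc j * 2 ^ l ≤ (2 * (j / 2) + 1) * 2 ^ l := by gcongr
      _ = _ := by ring

theorem predLevel_runs (hf : Monotone f) (hs : IsSubmodular f) {P : Params} {U : Finset V}
    (hP : P.Good f U) {es : List (Update V)} (hes : ∀ u ∈ es, u.elt ∈ U) (l : ℕ)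
    {t : ℕ → ℕ → Entry V} (ht : PredInv f P es (l + 1) (t (l + 1))) :
    (predLevel P es l t).Runs f (PredInv f P es l) (P.cost * es.length) := by
  have h2 := Nat.two_pow_pos l
  refine (loop_runs (Q := fun j (e : Entry V) => j * 2 ^ l ≤ es.length →
    e.Valid f P.k P.τ (P.p * (P.K * 2 ^ l)) ∧ e.W = active (es.take (j * 2 ^ l)))
    (c := fun _ => P.cost * 2 ^ l) (fun j hj => ?_) fun j hj hjl => ?_).le ?_
  · rw [List.mem_range'_1] at hj
    have hjN : j * 2 ^ l ≤ es.length :=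
      (Nat.le_div_iff_mul_le h2).1 (by omega)
    obtain ⟨ha, hb⟩ := half_mul_two_pow l j
    obtain ⟨hv, hW⟩ := ht (j / 2) (ha.trans hjN)
    refine ((build_runs hf hs hP.fuel hP.pos (fun x hx => hP.lt x (active_subset
      (fun u hu => hes u (List.mem_of_mem_take hu)) hx)) (P.K * 2 ^ l) hv le_rfl).mono
      (fun e he _ => he) le_rfl).le (level_cost_le P ?_)
    rw [hW]
    have := (card_sdiff_active_take_le es ha).1
    omega
  · have : j = 0 := by
      by_contra h0
      refine hj (List.mem_range'_1.2 ⟨by omega, ?_⟩)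
      have := (Nat.le_div_iff_mul_le h2).2 hjl
      omega
    subst this
    exact ⟨Entry.root_valid _ _ _, by simp [Entry.root, active]⟩
  · rw [List.map_const', List.sum_replicate, List.length_range', smul_eq_mul]
    calc es.length / 2 ^ l * (P.cost * 2 ^ l) = P.cost * (es.length / 2 ^ l * 2 ^ l) := by ring
      _ ≤ _ := Nat.mul_le_mul_left _ (Nat.div_mul_le_self _ _)

theorem guessPre_runs (hf : Monotone f) (hs : IsSubmodular f) {P : Params} {U : Finset V}
    (hP : P.Good f U) {es : List (Update V)} (hes : ∀ u ∈ es, u.elt ∈ U) :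
    (guessPre P es).Runs f (GuessInv f P es []) (es.length.size * (P.cost * es.length)) := by
  refine ((descend_runs (I := fun n t => ∀ l, n ≤ l → PredInv f P es l (t l))
    (c := fun _ => P.cost * es.length) (fun n t ht => ?_) es.length.size
    (fun l hl j hj => ?_)).bind (c' := 0) fun t ht => ?_).le (by simp)
  · refine (predLevel_runs hf hs hP hes n (ht (n + 1) le_rfl)).mono (fun r hr l hl => ?_) le_rfl
    by_cases hln : l = n
    · subst hln
      rwa [Function.update_self]
    · rw [Function.update_of_ne hln]
      exact ht l (by omega)
  · have hlt : es.length < 2 ^ l := Nat.size_le.1 hl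
    have : j = 0 := by
      by_contra h0
      have : 1 * 2 ^ l ≤ j * 2 ^ l := Nat.mul_le_mul_right _ (by omega)
      omega
    subst this
    exact ⟨Entry.root_valid _ _ _, by simp [Entry.root, active]⟩
  · exact ⟨fun l => ht l (Nat.zero_le l), fun l => ⟨Entry.root_valid _ _ _, by simp [active]⟩,
      Entry.root_valid _ _ _, rfl⟩

/-- A bound on the number of queries for the first `T` updates, if at most `H` elements are in the
actual but not the predicted set or vice versa at any time: each of the levels with `2 ^ l < H` is
recomputed once in `2 ^ l` updates. -/
def budget (P : Params) (H T : ℕ) : ℕ :=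
  P.cost * (∑ l ∈ Finset.range H.size, 2 ^ l * (T / 2 ^ l) + T)

theorem budget_le (P : Params) (H T : ℕ) : budget P H T ≤ P.cost * (H.size + 1) * T := by
  rw [budget, mul_assoc, add_mul, one_mul]
  gcongr
  calc _ ≤ ∑ _l ∈ Finset.range H.size, T :=
        Finset.sum_le_sum fun l _ => Nat.mul_div_le _ _
    _ = _ := by simp

theorem budget_succ (P : Params) (H T : ℕ) : budget P H (T + 1) = budget P H T +
    (P.cost * (∑ l ∈ Finset.range H.size, if 2 ^ l ∣ T + 1 then 2 ^ l else 0) + P.cost) := by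
  have : ∀ l ∈ Finset.range H.size, 2 ^ l * ((T + 1) / 2 ^ l) =
      2 ^ l * (T / 2 ^ l) + if 2 ^ l ∣ T + 1 then 2 ^ l else 0 := fun l _ => by
    rw [Nat.succ_div]; split_ifs <;> ring
  rw [budget, Finset.sum_congr rfl this, Finset.sum_add_distrib, budget]
  ring

/-- An entry of level `l` does not have to be replaced if the number of updates is not a multiple of
`2 ^ l`. -/
theorem StackInv.append {P : Params} {us : List (Update V)} {u : Update V} {l : ℕ} {e : Entry V}
    (h : ¬ 2 ^ l ∣ us.length + 1) (he : StackInv f P us l e) : StackInv f P (us ++ [u]) l e := by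
  refine ⟨he.1, ?_⟩
  rw [List.length_append, List.length_singleton, roundDown_succ_of_not_dvd h,
    List.take_append_of_le_length (roundDown_le _ _)]
  exact he.2

theorem StackInv.card_sdiff_le {P : Params} {us : List (Update V)} {l : ℕ} {e : Entry V}
    (h : StackInv f P us l e) : (active us \ e.W).card ≤ 3 * 2 ^ l := by
  have h1 := (card_sdiff_active_take_le us (roundDown_le l us.length)).1
  have h2 := lt_roundDown_add l us.length
  have h3 := h.2
  rw [List.take_length] at h1
  have := DynSubmod.card_sdiff_le (active us) (active (us.take (roundDown l us.length))) e.W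
  omega

theorem stackLevel_runs (hf : Monotone f) (hs : IsSubmodular f) {P : Params} {U : Finset V}
    (hP : P.Good f U) {es us : List (Update V)} {u : Update V}
    (hus : ∀ v ∈ us ++ [u], v.elt ∈ U) {i H : ℕ} (hi : i ≤ es.length)
    (hH : disc (active (us ++ [u])) (active (es.take i)) ≤ H) {pred : ℕ → ℕ → Entry V}
    (hpred : ∀ l, PredInv f P es l (pred l)) {l : ℕ} {st : ℕ → Entry V}
    (hold : StackInv f P us l (st l)) (hnew : StackInv f P (us ++ [u]) (l + 1) (st (l + 1))) :
    (stackLevel P es (us ++ [u]) i pred l st).Runs f (StackInv f P (us ++ [u]) l)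
      (if 2 ^ l < H ∧ 2 ^ l ∣ us.length + 1 then P.cost * 2 ^ l else 0) := by
  have hlen : (us ++ [u]).length = us.length + 1 := by simp
  rw [stackLevel]
  by_cases hd : 2 ^ l ∣ (us ++ [u]).length
  · rw [if_pos hd]
    by_cases hc : disc (active (us ++ [u])) (active (es.take i)) ≤ 2 ^ l
    · rw [if_pos hc]
      have hle : roundDown l i ≤ i := roundDown_le l i
      have hlt := lt_roundDown_add l i
      obtain ⟨h1, h2⟩ := hpred l (i / 2 ^ l) (hle.trans hi)
      refine ⟨h1, ?_⟩
      rw [roundDown_of_dvd hd, List.take_length, h2]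
      have h3 := (card_sdiff_active_take_le es hle).1
      refine (card_sdiff_le _ (active (es.take i)) _).trans ?_
      rw [disc] at hc
      rw [roundDown] at *
      omega
    · rw [if_neg hc, if_pos ⟨by omega, by rwa [← hlen]⟩]
      refine ((build_runs hf hs hP.fuel hP.pos (fun x hx => hP.lt x (active_subset hus hx))
        (P.K * 2 ^ l) hnew.1 le_rfl).mono (fun e he => ⟨he.1, by
          rw [he.2, roundDown_of_dvd hd, List.take_length]; simp⟩) le_rfl).le (level_cost_le P ?_)
      · have h2 := hnew.card_sdiff_le
        rw [pow_succ] at *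
        omega
  · rw [if_neg hd]
    exact hold.append (by rwa [← hlen])

theorem guessStep_runs (hf : Monotone f) (hs : IsSubmodular f) {P : Params} {U : Finset V}
    (hP : P.Good f U) {es us : List (Update V)} {u : Update V}
    (hus : ∀ v ∈ us ++ [u], v.elt ∈ U) {i H : ℕ} (hi : i ≤ es.length)
    (hH : disc (active (us ++ [u])) (active (es.take i)) ≤ H) {g : GuessState V}
    (hg : GuessInv f P es us g) :
    (guessStep P es (us ++ [u]) i g).Runs f (GuessInv f P es (us ++ [u]))
      (budget P H (us.length + 1) - budget P H us.length) := by
  have hlen : (us ++ [u]).length = us.length + 1 := by simp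
  refine ((descend_runs (I := fun n st => (∀ l, n ≤ l → StackInv f P (us ++ [u]) l (st l)) ∧
    ∀ l, l < n → StackInv f P us l (st l))
    (c := fun l => if 2 ^ l < H ∧ 2 ^ l ∣ us.length + 1 then P.cost * 2 ^ l else 0)
    (fun n st hst => ?_) (us ++ [u]).length (s := g.stack) ⟨fun l hl => ?_, fun l _ => hg.stack l⟩).bind
    (Q' := GuessInv f P es (us ++ [u])) (c' := P.cost) fun st hst => ?_).le ?_
  · refine (stackLevel_runs hf hs hP hus hi hH hg.pred (hst.2 n (Nat.lt_succ_self n))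
      (hst.1 (n + 1) le_rfl)).mono (fun e he => ⟨fun l hl => ?_, fun l hl => ?_⟩) le_rfl
    · by_cases hln : l = n
      · subst hln
        rwa [Function.update_self]
      · rw [Function.update_of_ne hln]
        exact hst.1 l (by omega)
    · rw [Function.update_of_ne hl.ne]
      exact hst.2 l (by omega)
  · refine (hg.stack l).append fun hd => ?_
    have h1 := Nat.le_of_dvd (Nat.succ_pos _) hd
    have h2 : l < 2 ^ l := Nat.lt_two_pow_self
    omega
  · refine Runs.le (Runs.bind (build_runs hf hs hP.fuel hP.pos
      (fun x hx => hP.lt x (active_subset hus hx)) 0 (hst.1 0 le_rfl).1 le_rfl) (c' := 0)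
      fun e he => ?_) ?_
    · rw [mul_zero] at he
      exact GuessInv.mk hg.pred (fun l => hst.1 l (Nat.zero_le l)) he
    · refine (level_cost_le P (l := 0) ?_).trans (by simp)
      have := (hst.1 0 le_rfl).card_sdiff_le
      rw [pow_succ]
      nlinarith
  · rw [budget_succ, Nat.add_sub_cancel_left, Finset.mul_sum]
    refine Nat.add_le_add_right ?_ _
    rw [← Finset.sum_filter]
    simp_rw [mul_ite, mul_zero]
    rw [← Finset.sum_filter]
    refine Finset.sum_le_sum_of_subset fun l hl => ?_
    simp only [Finset.mem_filter, Finset.mem_range] at hl ⊢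
    exact ⟨Nat.lt_size.2 hl.2.1.le, hl.2.2⟩

/-- The set `A` misses few elements of the set for which the entry `pred l j` is computed. -/
def PredNear (es : List (Update V)) (l j : ℕ) (A : Finset V) : Prop :=
  j * 2 ^ l ≤ es.length ∧ (active (es.take (j * 2 ^ l)) \ A).card ≤ 4 * 2 ^ l

/-- The set `A` misses few elements of the set that was active at the time to which the entry of level
`l` of the stack belongs. -/
def StackNear (us : List (Update V)) (l : ℕ) (A : Finset V) : Prop :=
  (active (us.take (roundDown l us.length)) \ A).card ≤ 2 * 2 ^ l

/-- The partial solutions keep, in expectation, the fraction `1 - lam` of their value when they are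
restricted to sets that are close to those for which they were computed. Since these sets do not
depend on random choices, neither do the sets that `A` ranges over. -/
structure GuessExpect (f : Finset V → ℝ) (lam : ℝ) (es us : List (Update V))
    (Q : Proc V (GuessState V)) : Prop where
  pred : ∀ l j A, PredNear es l j A → 0 ≤ Q.expect f fun g => potential f lam A (g.pred l j).G
  stack : ∀ l A, StackNear us l A → 0 ≤ Q.expect f fun g => potential f lam A (g.stack l).G
  fin : 0 ≤ Q.expect f fun g => potential f lam (active us) g.fin.G

theorem potential_root (lam : ℝ) (A : Finset V) :
    potential f lam A (Entry.root : Entry V).G = 0 := potential_empty lam A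

/-- The entries of the predicted tree are robust: the bound `4 * 2 ^ l` on the number of missing
elements leaves room for the differences between consecutive levels, and is small compared with the
size `K * 2 ^ l` at which the selection for level `l` stops. -/
theorem guessPre_expect (hf : Monotone f) (hs : IsSubmodular f) {P : Params} {U : Finset V}
    (hP : P.Good f U) {lam : ℝ} (hlam : 0 ≤ lam) (hK : 8 ≤ lam * P.K) (es : List (Update V)) :
    GuessExpect f lam es [] (guessPre P es) := by
  refine ⟨fun l j A hA => ?_, fun l A _ => ?_, ?_⟩
  · rw [guessPre, expect_bind]
    simp only [expect]
    have key := descend_expect (f := f) (α := ℕ → Entry V) (σ := Unit)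
      (h := fun _ => predLevel P es)
      (old := fun _ => ∅) (base := {fun _ => 0})
      (new := fun l => {g | ∃ j A, PredNear es l j A ∧ g = fun r => potential f lam A (r j).G})
      ?_ es.length.size (done ((), fun _ _ => Entry.root)) ?_ ?_ ?_ l _ ⟨j, A, hA, rfl⟩
    · exact key
    · rintro l _ ⟨j, A, ⟨hj, hA⟩, rfl⟩
      by_cases hjl : j ∈ List.range' 1 (es.length / 2 ^ l)
      · refine Or.inr (Or.inl ⟨_, ⟨j / 2, A, ?_, rfl⟩, fun _ t => ?_⟩)
        · obtain ⟨ha, hb⟩ := half_mul_two_pow l j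
          refine ⟨ha.trans hj, ?_⟩
          have h1 := (card_sdiff_active_take_le es ha).2
          have h2 := card_sdiff_le (active (es.take (j / 2 * 2 ^ (l + 1))))
            (active (es.take (j * 2 ^ l))) A
          rw [pow_succ] at *
          omega
        · rw [predLevel, loop_expect_of_mem _ List.nodup_range' hjl
            fun e : Entry V => potential f lam A e.G]
          refine build_expect hf hs hP.fuel hP.pos hlam ?_ _
          have hA' : ((active (es.take (j * 2 ^ l)) \ A).card : ℝ) ≤ 4 * 2 ^ l := by
            exact_mod_cast hA
          have : 8 * (2 : ℝ) ^ l ≤ lam * P.K * 2 ^ l := by gcongr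
          push_cast
          linarith
      · refine Or.inr (Or.inr ⟨_, rfl, fun _ t => ?_⟩)
        rw [predLevel, loop_expect_of_notMem _ hjl
          fun e : Entry V => potential f lam A e.G, potential_root]
    · rintro b rfl
      exact le_rfl
    · rintro m _ g ⟨j, A, _, rfl⟩
      exact (potential_root lam A).ge
    · rintro m _ g hg
      exact absurd hg (Set.notMem_empty g)
  · rw [guessPre, expect_bind]
    exact le_expect_of_always (always_of_forall fun t => (potential_root lam A).ge)
  · rw [guessPre, expect_bind]
    exact le_expect_of_always (always_of_forall fun t => (potential_root lam _).ge)

/-- The entries of the stack are robust, whether they are computed from the next level or taken from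
the predicted tree; in the latter case, the distance between the actual and the predicted set adds to
the number of missing elements. -/
theorem guessStep_expect (hf : Monotone f) (hs : IsSubmodular f) {P : Params} {U : Finset V}
    (hP : P.Good f U) {lam : ℝ} (hlam : 0 ≤ lam) (hK : 8 ≤ lam * P.K) {es us : List (Update V)}
    {u : Update V} {i : ℕ} (hi : i ≤ es.length) {Q : Proc V (GuessState V)}
    (hQ : GuessExpect f lam es us Q) :
    GuessExpect f lam es (us ++ [u]) (Q.bind (guessStep P es (us ++ [u]) i)) := by
  have hlen : (us ++ [u]).length = us.length + 1 := by simp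
  have hsame : ∀ l A, ¬ 2 ^ l ∣ us.length + 1 → StackNear (us ++ [u]) l A → StackNear us l A := by
    intro l A hd h
    rwa [StackNear, List.length_append, List.length_singleton, roundDown_succ_of_not_dvd hd,
      List.take_append_of_le_length (roundDown_le _ _)] at h
  have hstack : ∀ l A, StackNear (us ++ [u]) l A → 0 ≤ (Q.bind fun g =>
      descend (stackLevel P es (us ++ [u]) i g.pred) (us ++ [u]).length g.stack).expect f
        fun st => potential f lam A (st l).G := by
    intro l A hA
    have key := descend_expect (f := f) (α := Entry V) (σ := ℕ → ℕ → Entry V)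
      (h := stackLevel P es (us ++ [u]) i)
      (old := fun l => {g | ∃ A, StackNear us l A ∧ g = fun e => potential f lam A e.G})
      (base := {b | ∃ l j A, PredNear es l j A ∧ b = fun t => potential f lam A (t l j).G})
      (new := fun l => {g | ∃ A, StackNear (us ++ [u]) l A ∧ g = fun e => potential f lam A e.G})
      ?_ (us ++ [u]).length (Q.bind fun g => done (g.pred, g.stack)) ?_ ?_ ?_ l _ ⟨A, hA, rfl⟩
    · rw [bind_assoc] at key
      exact key
    · rintro l _ ⟨A, hA, rfl⟩
      by_cases hd : 2 ^ l ∣ (us ++ [u]).length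
      · have hA' := hA
        rw [StackNear, roundDown_of_dvd hd, List.take_length] at hA'
        by_cases hc : disc (active (us ++ [u])) (active (es.take i)) ≤ 2 ^ l
        · refine Or.inr (Or.inr ⟨_, ⟨l, i / 2 ^ l, A, ?_, rfl⟩, fun t st => ?_⟩)
          · have hle := roundDown_le l i
            have hlt := lt_roundDown_add l i
            have h1 := (card_sdiff_active_take_le es hle).2
            have h2 := card_sdiff_le (active (es.take (roundDown l i))) (active (es.take i)) A
            have h3 := card_sdiff_le (active (es.take i)) (active (us ++ [u])) A
            rw [disc] at hc
            refine ⟨hle.trans hi, ?_⟩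
            rw [roundDown] at *
            omega
          · rw [stackLevel, if_pos hd, if_pos hc]
            exact le_rfl
        · refine Or.inr (Or.inl ⟨_, ⟨A, ?_, rfl⟩, fun t st => ?_⟩)
          · have hle := roundDown_le (l + 1) (us ++ [u]).length
            have hlt := lt_roundDown_add (l + 1) (us ++ [u]).length
            have h1 := (card_sdiff_active_take_le (us ++ [u]) hle).2
            rw [List.take_length] at h1
            have h2 := card_sdiff_le (active ((us ++ [u]).take (roundDown (l + 1)
              (us ++ [u]).length))) (active (us ++ [u])) A
            rw [StackNear]
            rw [pow_succ] at *
            omega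
          · rw [stackLevel, if_pos hd, if_neg hc]
            refine build_expect hf hs hP.fuel hP.pos hlam ?_ _
            have hA'' : ((active (us ++ [u]) \ A).card : ℝ) ≤ 2 * 2 ^ l := by exact_mod_cast hA'
            have : 8 * (2 : ℝ) ^ l ≤ lam * P.K * 2 ^ l := by gcongr
            have : (0 : ℝ) < 2 ^ l := by positivity
            push_cast
            linarith
      · refine Or.inl ⟨_, ⟨A, hsame l A (by rwa [← hlen]) hA, rfl⟩, fun t st => ?_⟩
        rw [stackLevel, if_neg hd]
        exact le_rfl
    · rintro b ⟨l, j, A, hA, rfl⟩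
      rw [expect_bind]
      exact hQ.pred l j A hA
    · rintro m hm g ⟨A, hA, rfl⟩
      rw [expect_bind]
      refine hQ.stack m A (hsame m A (fun hd => ?_) hA)
      have h1 := Nat.le_of_dvd (Nat.succ_pos _) hd
      have h2 : m < 2 ^ m := Nat.lt_two_pow_self
      omega
    · rintro m _ g ⟨A, hA, rfl⟩
      rw [expect_bind]
      exact hQ.stack m A hA
  refine ⟨fun l j A hA => ?_, fun l A hA => ?_, ?_⟩
  · simpa only [guessStep, expect_bind, expect, expect_const] using hQ.pred l j A hA
  · simpa only [guessStep, expect_bind, expect, expect_const] using hstack l A hA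
  · have h0 := hstack 0 (active (us ++ [u])) (by
      rw [StackNear, roundDown_of_dvd (by simp), List.take_length]
      simp)
    simp only [guessStep, expect_bind, expect] at h0 ⊢
    refine h0.trans (expect_mono (always_of_forall fun g => expect_mono (always_of_forall
      fun st => build_expect hf hs hP.fuel hP.pos hlam ?_ _)))
    simp

end Guess

/-! ### Predicted and actual active sets -/

section Predicted

variable {V : Type} [DecidableEq V]

theorem foldl_ins (L : List V) (W : Finset V) (x : V) :
    x ∈ (L.map Update.ins).foldl Update.apply W ↔ x ∈ W ∨ x ∈ L := by
  induction L generalizing W with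
  | nil => simp
  | cons a L ih =>
    rw [List.map_cons, List.foldl_cons, ih]
    simp only [Update.apply, Finset.mem_insert, List.mem_cons]
    tauto

theorem foldl_del (L : List V) (W : Finset V) (x : V) :
    x ∈ (L.map Update.del).foldl Update.apply W ↔ x ∈ W ∧ x ∉ L := by
  induction L generalizing W with
  | nil => simp
  | cons a L ih =>
    rw [List.map_cons, List.foldl_cons, ih]
    simp only [Update.apply, Finset.mem_erase, List.mem_cons]
    tauto

variable [Fintype V]

open Classical in
/-- The updates that are predicted for time `t`. Elements that are predicted to be deleted no later
than they are inserted are ignored. -/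
noncomputable def predAt (p : Prediction V) (t : ℕ) : List (Update V) :=
  (Finset.univ.filter fun a => p.insTime a = t ∧ p.insTime a < p.delTime a).toList.map .ins ++
    (Finset.univ.filter fun a => p.delTime a = t ∧ p.insTime a < p.delTime a).toList.map .del

/-- The updates that are predicted for times before `n`. -/
noncomputable def predList (p : Prediction V) (n : ℕ) : List (Update V) :=
  (List.range n).flatMap (predAt p)

omit [DecidableEq V] in
theorem predList_succ (p : Prediction V) (n : ℕ) :
    predList p (n + 1) = predList p n ++ predAt p n := by
  simp [predList, List.range_succ]

omit [DecidableEq V] in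
theorem predList_prefix (p : Prediction V) {i j : ℕ} (h : i ≤ j) :
    predList p i <+: predList p j := by
  induction j, h using Nat.le_induction with
  | base => exact List.prefix_rfl
  | succ j _ ih => exact ih.trans (predList_succ p j ▸ List.prefix_append _ _)

theorem mem_active_predList (p : Prediction V) (n : ℕ) (a : V) :
    a ∈ active (predList p n) ↔ p.insTime a < n ∧ ¬ p.delTime a < n := by
  induction n with
  | zero => simp [predList, active]
  | succ n ih =>
    rw [predList_succ, active_append, predAt, List.foldl_append, foldl_del, foldl_ins, ih]
    simp only [Finset.mem_toList, Finset.mem_filter, Finset.mem_univ, true_and, Nat.cast_add,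
      Nat.cast_one]
    generalize p.insTime a = s
    generalize p.delTime a = t
    have key : ∀ x : ℕ∞, x < (n : ℕ∞) + 1 ↔ x < n ∨ x = n := fun x => by
      rw [ENat.lt_add_one_iff (ENat.natCast_ne_top n), le_iff_lt_or_eq]
    rw [key, key]
    constructor
    · rintro ⟨h | h, h'⟩
      · exact ⟨Or.inl h.1, fun h'' => h''.elim h.2 fun e => h' ⟨e, e ▸ h.1⟩⟩
      · exact ⟨Or.inr h.1, fun h'' => h''.elim (fun e => absurd (h.1 ▸ h.2) (not_lt.2 e.le))
          fun e => h' ⟨e, h.2⟩⟩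
    · rintro ⟨h, h'⟩
      rw [not_or] at h'
      refine ⟨?_, fun e => h'.2 e.1⟩
      rcases h with h | h
      · exact Or.inl ⟨h, h'.1⟩
      · exact Or.inr ⟨h, h ▸ lt_of_le_of_ne (not_lt.1 h'.1) fun e => h'.2 e.symm⟩

/-- All finite predicted times are smaller than this. -/
def horizon (p : Prediction V) : ℕ := ∑ a, ((p.insTime a).toNat + (p.delTime a).toNat) + 1

omit [DecidableEq V] in
theorem lt_horizon (p : Prediction V) (a : V) :
    (p.insTime a).toNat < horizon p ∧ (p.delTime a).toNat < horizon p := by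
  have := Finset.single_le_sum (f := fun a => (p.insTime a).toNat + (p.delTime a).toNat)
    (fun _ _ => Nat.zero_le _) (Finset.mem_univ a)
  simp only [horizon]
  omega

/-- All predicted updates, in chronological order. -/
noncomputable def allPred (p : Prediction V) : List (Update V) := predList p (horizon p)

/-- The predicted updates up to time `t`, as an initial segment of all of them. -/
noncomputable def predUpTo (p : Prediction V) (t : ℕ) : List (Update V) :=
  predList p (min (t + 1) (horizon p))

omit [DecidableEq V] in
theorem predUpTo_prefix (p : Prediction V) (t : ℕ) : predUpTo p t <+: allPred p :=
  predList_prefix p (min_le_right _ _)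

theorem mem_active_predUpTo (p : Prediction V) (t : ℕ) (a : V) :
    a ∈ active (predUpTo p t) ↔ p.insTime a ≤ t ∧ ¬ p.delTime a ≤ t := by
  have key : ∀ x : ℕ∞, x.toNat < horizon p →
      (x < (min (t + 1) (horizon p) : ℕ) ↔ x ≤ t) := by
    intro x hx
    induction x using ENat.recTopCoe with
    | top => simp
    | coe x =>
      rw [ENat.toNat_natCast] at hx
      rw [Nat.cast_lt, Nat.cast_le]
      omega
  rw [predUpTo, mem_active_predList, key _ (lt_horizon p a).1, key _ (lt_horizon p a).2]

omit [DecidableEq V] in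
theorem length_le_of_nodup {us : List (Update V)} (h : us.Nodup) :
    us.length ≤ 2 * Fintype.card V := by
  let g : Update V → V ⊕ V := fun u => match u with
    | .ins a => Sum.inl a
    | .del a => Sum.inr a
  have hg : Function.Injective g := by
    rintro (a | a) (b | b) hab <;> simp_all [g]
  have := (h.map hg).length_le_card
  rw [List.length_map, Fintype.card_sum] at this
  omega

omit [DecidableEq V] in
theorem predList_nodup (p : Prediction V) (n : ℕ) : (predList p n).Nodup := by
  rw [predList, List.nodup_flatMap]
  constructor
  · intro t _
    refine List.Nodup.append ((Finset.nodup_toList _).map fun a b h => by injection h)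
      ((Finset.nodup_toList _).map fun a b h => by injection h) ?_
    intro u h1 h2
    rw [List.mem_map] at h1 h2
    obtain ⟨a, -, rfl⟩ := h1
    obtain ⟨b, -, h⟩ := h2
    cases h
  · refine List.nodup_range.imp fun {s t} hst => ?_
    intro u h1 h2
    simp only [predAt, List.mem_append, List.mem_map, Finset.mem_toList, Finset.mem_filter,
      Finset.mem_univ, true_and] at h1 h2
    rcases h1 with ⟨a, ha, rfl⟩ | ⟨a, ha, rfl⟩ <;> rcases h2 with ⟨b, hb, h⟩ | ⟨b, hb, h⟩ <;> cases h
    all_goals exact hst (by exact_mod_cast ha.1.symm.trans hb.1)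

omit [DecidableEq V] [Fintype V] in
theorem IsStream.of_append {us vs : List (Update V)} (h : IsStream (us ++ vs)) : IsStream us := by
  refine ⟨(List.nodup_append.1 h.1).1, fun i a hi => ?_⟩
  have hlt : i < us.length := (List.getElem?_eq_some_iff.1 hi).1
  obtain ⟨j, hj, hja⟩ := h.2 i a (by rw [List.getElem?_append_left hlt, hi])
  exact ⟨j, hj, by rwa [List.getElem?_append_left (hj.trans hlt)] at hja⟩

omit [DecidableEq V] [Fintype V] in
theorem IsStream.take {us : List (Update V)} (h : IsStream us) (t : ℕ) : IsStream (us.take t) :=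
  IsStream.of_append (vs := us.drop t) (by rwa [List.take_append_drop])

omit [Fintype V] in
theorem IsStream.mem_active {us : List (Update V)} (h : IsStream us) (a : V) :
    a ∈ active us ↔ Update.ins a ∈ us ∧ Update.del a ∉ us := by
  induction us using List.reverseRecOn with
  | nil => simp [active]
  | append_singleton us u ih =>
    have ih := ih h.of_append
    rw [active_append]
    have hu : u ∉ us := fun hu => (List.nodup_append.1 h.1).2.2 u hu u (by simp) rfl
    cases u with
    | ins b =>
      have hb : Update.del b ∉ us := fun hb => by
        obtain ⟨i, hi⟩ := List.mem_iff_getElem?.1 hb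
        obtain ⟨j, -, hj⟩ := h.of_append.2 i b hi
        exact hu (List.mem_iff_getElem?.2 ⟨j, hj⟩)
      simp only [List.foldl_cons, List.foldl_nil, Update.apply, Finset.mem_insert, ih,
        List.mem_append, List.mem_singleton, Update.ins.injEq, reduceCtorEq, or_false]
      constructor
      · rintro (rfl | h')
        · exact ⟨Or.inr rfl, hb⟩
        · exact ⟨Or.inl h'.1, h'.2⟩
      · rintro ⟨h1 | h1, h2⟩
        · exact Or.inr ⟨h1, h2⟩
        · exact Or.inl h1
    | del b =>
      simp only [List.foldl_cons, List.foldl_nil, Update.apply, Finset.mem_erase, ih,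
        List.mem_append, List.mem_singleton, Update.del.injEq, reduceCtorEq, or_false, not_or]
      tauto

omit [DecidableEq V] [Fintype V] in
theorem timeOf_le_iff (us : List (Update V)) (u : Update V) (t : ℕ) :
    timeOf us u ≤ t ↔ ∃ i, us[i]? = some u ∧ i + 1 ≤ t := by
  rw [← ENat.lt_add_one_iff (ENat.natCast_ne_top t), timeOf]
  simp only [iInf_lt_iff]
  refine exists_congr fun i => ?_
  rw [exists_prop]
  refine and_congr_right fun _ => ?_
  rw [ENat.lt_add_one_iff (ENat.natCast_ne_top t), Nat.cast_le]

omit [DecidableEq V] [Fintype V] in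
theorem exists_of_timeOf_eq {us : List (Update V)} {u : Update V} {s : ℕ} (h : timeOf us u = s) :
    us[s - 1]? = some u := by
  obtain ⟨i, hi, his⟩ := (timeOf_le_iff us u s).1 h.le
  have : timeOf us u ≤ (i + 1 : ℕ) := (timeOf_le_iff us u _).2 ⟨i, hi, le_rfl⟩
  rw [h, Nat.cast_le] at this
  obtain rfl : s = i + 1 := by omega
  exact hi

omit [DecidableEq V] [Fintype V] in
theorem timeOf_le_iff_mem_take (us : List (Update V)) (u : Update V) (t : ℕ) :
    timeOf us u ≤ t ↔ u ∈ us.take t := by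
  rw [timeOf_le_iff, List.mem_iff_getElem?]
  refine exists_congr fun i => ?_
  rw [List.getElem?_take]
  split_ifs with h
  · simp [h]
  · simp [h]

/-- If a predicted and an actual time are close to each other and the time `t` separates them, then
the actual time is close to `t`. -/
theorem Within.exists_near {w t : ℕ} {x y : ℕ∞} (h : Within w x y) (ht : ¬ (x ≤ t ↔ y ≤ t)) :
    ∃ s : ℕ, y = s ∧ s ∈ Finset.Icc (t - w) (t + w) := by
  obtain ⟨h1, h2⟩ := h
  induction y using ENat.recTopCoe with
  | top =>
    exfalso
    induction x using ENat.recTopCoe with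
    | top => simp at ht
    | coe x =>
      rw [top_le_iff] at h2
      exact absurd h2 (by exact_mod_cast ENat.natCast_ne_top (x + w))
  | coe y =>
    induction x using ENat.recTopCoe with
    | top =>
      rw [top_le_iff] at h1
      exact absurd h1 (by exact_mod_cast ENat.natCast_ne_top (y + w))
    | coe x =>
      norm_cast at h1 h2 ht
      refine ⟨y, rfl, ?_⟩
      rw [Finset.mem_Icc]
      omega

/-- Only erroneous elements, and those with an update within `w` time steps of `t`, can be actually
but not predictedly active at time `t`, or vice versa. -/
theorem disc_active_le (w : ℕ) (p : Prediction V) {us : List (Update V)} (h : IsStream us)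
    (t : ℕ) :
    disc (active (us.take t)) (active (predUpTo p t)) ≤ predictionError w p us + (2 * w + 1) := by
  classical
  set E := Finset.univ.filter fun a : V => ¬ (Within w (p.insTime a) (timeOf us (.ins a)) ∧
    Within w (p.delTime a) (timeOf us (.del a))) with hE
  set N := (Finset.Icc (t - w) (t + w)).biUnion fun s => ((us[s - 1]?).map Update.elt).toFinset
    with hN
  have hEc : E.card = predictionError w p us := by
    rw [predictionError, ← Set.ncard_coe_finset]
    congr 1
    ext a
    simp [hE]
  have hNc : N.card ≤ 2 * w + 1 := by
    refine (Finset.card_biUnion_le_card_mul _ _ 1 fun s _ => ?_).trans ?_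
    · cases us[s - 1]? <;> simp
    · rw [Nat.card_Icc]
      omega
  rw [disc, ← Finset.card_union_of_disjoint (Finset.disjoint_left.2 fun x h1 h2 =>
    (Finset.mem_sdiff.1 h1).2 (Finset.mem_sdiff.1 h2).1), ← hEc]
  refine (Finset.card_le_card (t := E ∪ N) fun a ha => ?_).trans
    ((Finset.card_union_le _ _).trans (by omega))
  rw [Finset.mem_union]
  by_cases haE : a ∈ E
  · exact Or.inl haE
  right
  rw [hE, Finset.mem_filter, not_and, not_not] at haE
  obtain ⟨h1, h2⟩ := haE (Finset.mem_univ _)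
  have hne : ¬ (p.insTime a ≤ t ↔ timeOf us (.ins a) ≤ t) ∨
      ¬ (p.delTime a ≤ t ↔ timeOf us (.del a) ≤ t) := by
    by_contra hcon
    rw [not_or, not_not, not_not] at hcon
    have hiff : a ∈ active (us.take t) ↔ a ∈ active (predUpTo p t) := by
      rw [(h.take t).mem_active, mem_active_predUpTo, ← timeOf_le_iff_mem_take,
        ← timeOf_le_iff_mem_take, hcon.1, hcon.2]
    rw [Finset.mem_union, Finset.mem_sdiff, Finset.mem_sdiff, hiff] at ha
    tauto
  rw [hN, Finset.mem_biUnion]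
  rcases hne with hne | hne
  · obtain ⟨s, hs, hst⟩ := h1.exists_near hne
    exact ⟨s, hst, by rw [exists_of_timeOf_eq hs]; simp [Update.elt]⟩
  · obtain ⟨s, hs, hst⟩ := h2.exists_near hne
    exact ⟨s, hst, by rw [exists_of_timeOf_eq hs]; simp [Update.elt]⟩

end Predicted

/-! ### The algorithm -/

section Algorithm

open Proc

/-- The thresholds `b ^ i` for which an element of value `x` is relevant, namely those with
`b ^ i ≤ x ≤ B * b ^ i`. -/
noncomputable def guesses (b B x : ℝ) : Finset ℤ :=
  if 0 < x then Finset.Icc ⌈Real.logb b x - Real.logb b B⌉ ⌊Real.logb b x⌋ else ∅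

theorem mem_guesses {b B x : ℝ} (hb : 1 < b) (hB : 0 < B) (i : ℤ) :
    i ∈ guesses b B x ↔ 0 < x ∧ b ^ i ≤ x ∧ x ≤ B * b ^ i := by
  rw [guesses]
  split_ifs with hx
  · rw [Finset.mem_Icc, Int.ceil_le, Int.le_floor, ← Real.logb_div hx.ne' hB.ne',
      Real.logb_le_iff_le_rpow hb (div_pos hx hB), Real.le_logb_iff_rpow_le hb hx,
      Real.rpow_intCast, div_le_iff₀ hB, mul_comm B]
    tauto
  · simp [hx]

theorem card_guesses_le {b B : ℝ} (hb : 1 < b) (hB : 1 ≤ B) (x : ℝ) :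
    (guesses b B x).card ≤ ⌊Real.logb b B⌋₊ + 1 := by
  have hL : 0 ≤ Real.logb b B := Real.logb_nonneg hb hB
  rw [guesses]
  split_ifs with hx
  · rw [Int.card_Icc, Int.toNat_le]
    have h1 := Int.floor_le (Real.logb b x)
    have h2 := Int.le_ceil (Real.logb b x - Real.logb b B)
    have h3 : ⌊Real.logb b x⌋ - ⌈Real.logb b x - Real.logb b B⌉ ≤ ⌊Real.logb b B⌋ := by
      rw [Int.le_floor]
      push_cast
      linarith
    have h4 := Int.natCast_floor_eq_floor hL
    push_cast
    rw [h4]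
    linarith
  · simp

variable {V : Type} [DecidableEq V] {f : Finset V → ℝ}

/-- The largest value of an element of `W`. -/
noncomputable def maxValue (v : V → ℝ) (W : Finset V) : ℝ := W.fold max 0 v

theorem exists_eq_maxValue (v : V → ℝ) (W : Finset V) :
    maxValue v W = 0 ∨ ∃ a ∈ W, maxValue v W = v a := by
  induction W using Finset.induction_on with
  | empty => exact Or.inl rfl
  | insert a W ha ih =>
    rw [maxValue, Finset.fold_insert ha]
    rcases max_choice (v a) (W.fold max 0 v) with h | h
    · exact Or.inr ⟨a, Finset.mem_insert_self _ _, h⟩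
    · rw [h]
      exact ih.imp_right fun ⟨b, hb, h⟩ => ⟨b, Finset.mem_insert_of_mem hb, h⟩

omit [DecidableEq V] in
theorem le_maxValue (v : V → ℝ) {W : Finset V} {a : V} (ha : a ∈ W) : v a ≤ maxValue v W :=
  (Finset.le_fold_max _).2 (Or.inr ⟨a, ha, le_rfl⟩)

open Classical in
/-- The best one of a list of sets and the empty set. -/
noncomputable def best (v : Finset V → ℝ) (L : List (Finset V)) : Finset V :=
  L.foldr (fun S T => if v T ≤ v S then S else T) ∅

omit [DecidableEq V] in
theorem best_spec (v : Finset V → ℝ) (L : List (Finset V)) :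
    best v L ∈ ∅ :: L ∧ ∀ S ∈ L, v S ≤ v (best v L) := by
  induction L with
  | nil => simp [best]
  | cons S L ih =>
    simp only [best, List.foldr_cons] at ih ⊢
    split_ifs with h
    · refine ⟨by simp, fun T hT => ?_⟩
      rcases List.mem_cons.1 hT with rfl | hT
      · exact le_rfl
      · exact (ih.2 T hT).trans h
    · refine ⟨?_, fun T hT => ?_⟩
      · rcases List.mem_cons.1 ih.1 with h' | h'
        · rw [h']; simp
        · exact List.mem_cons_of_mem _ (List.mem_cons_of_mem _ h')
      · rcases List.mem_cons.1 hT with rfl | hT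
        · exact (not_le.1 h).le
        · exact ih.2 T hT

/-- The parameters of the algorithm: those for a single threshold, the base `b` of the thresholds,
and the bound `B` on the ratio of the value of an element to the thresholds it is relevant for. -/
structure AlgParams : Type where
  k : ℕ
  n : ℕ
  p : ℕ
  K : ℕ
  b : ℝ
  B : ℝ

/-- The parameters for the threshold `b ^ i`. -/
noncomputable def AlgParams.at (θ : AlgParams) (i : ℤ) : Params := ⟨θ.k, θ.n, θ.p, θ.K, θ.b ^ i⟩

/-- The requirements on the parameters: the number of steps of the binary searches suffices, `B` is
large enough for the threshold that matters to be relevant for all active elements, and the bands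
cover the values of all relevant elements. -/
structure AlgParams.Good (θ : AlgParams) : Prop where
  fuel : θ.k < 2 ^ θ.n
  one_lt : 1 < θ.b
  le_two : θ.b ≤ 2
  one_le : 1 ≤ θ.B
  le : 4 * (θ.k : ℝ) ≤ θ.B
  lt : θ.B < 2 ^ θ.p

/-- The state of the algorithm: the values of the elements, the past updates, the states of the
algorithms for all thresholds, and the maintained solution. -/
structure AlgState (V : Type) : Type where
  value : V → ℝ
  hist : List (Update V)
  gs : ℤ → GuessState V
  out : Finset V

open Classical in
/-- The updates of elements for which the threshold `b ^ i` is relevant. -/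
noncomputable def localUpdates (θ : AlgParams) (v : V → ℝ) (i : ℤ) (us : List (Update V)) :
    List (Update V) :=
  us.filter fun u => i ∈ guesses θ.b θ.B (v u.elt)

/-- The updates of the state for each threshold that is relevant for the updated element. -/
noncomputable def stepGuesses [Fintype V] (θ : AlgParams) (p : Prediction V) (v : V → ℝ)
    (us : List (Update V)) (u : Update V) (gs : ℤ → GuessState V) :
    Proc V (ℤ → GuessState V) :=
  loop (fun i => guessStep (θ.at i) (localUpdates θ v i (allPred p))
    (localUpdates θ v i (us ++ [u]))
    (localUpdates θ v i (predUpTo p (us ++ [u]).length)).length (gs i))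
    (guesses θ.b θ.B (v u.elt)).toList gs

/-- The candidates for the solution, for the set `W` of active elements. -/
noncomputable def candidates (θ : AlgParams) (v : V → ℝ) (W : Finset V)
    (gs : ℤ → GuessState V) : List (Finset V) :=
  (guesses θ.b θ.B (maxValue v W)).toList.map fun i => (gs i).fin.G ∩ W

/-- The preprocessing phase: determine the values of all elements, and run the preprocessing phase
for all relevant thresholds. -/
noncomputable def algPre [Fintype V] (θ : AlgParams) (p : Prediction V) : Proc V (AlgState V) :=
  (evalOn (∅ :: Finset.univ.toList.map fun a => insert a ∅)).bind fun y =>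
    (loop (fun i => guessPre (θ.at i)
        (localUpdates θ (fun a => y (insert a ∅) - y ∅) i (allPred p)))
      (Finset.univ.biUnion fun a => guesses θ.b θ.B (y (insert a ∅) - y ∅)).toList
      fun _ => ⟨fun _ _ => Entry.root, fun _ => Entry.root, Entry.root⟩).bind fun gs =>
    done ⟨fun a => y (insert a ∅) - y ∅, [], gs, ∅⟩

/-- The reaction to an update. -/
noncomputable def algStep [Fintype V] (θ : AlgParams) (p : Prediction V) (s : AlgState V)
    (u : Update V) : Proc V (AlgState V) :=
  (stepGuesses θ p s.value s.hist u s.gs).bind fun gs =>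
    (evalOn (∅ :: candidates θ s.value (active (s.hist ++ [u])) gs)).bind fun y =>
      done ⟨s.value, s.hist ++ [u], gs,
        best y (candidates θ s.value (active (s.hist ++ [u])) gs)⟩

/-- The dynamic algorithm. -/
noncomputable def alg [Fintype V] (θ : AlgParams) (p : Prediction V) : DynAlg V :=
  ⟨AlgState V, algPre θ p, algStep θ p, AlgState.out⟩

/-- The processing of the updates `us`, starting from the state `s`. -/
noncomputable def algProcess [Fintype V] (θ : AlgParams) (p : Prediction V) (s : AlgState V)
    (us : List (Update V)) : Proc V (AlgState V) :=
  (alg θ p).process s us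

theorem algProcess_append [Fintype V] (θ : AlgParams) (p : Prediction V) (s : AlgState V)
    (us : List (Update V)) (u : Update V) :
    algProcess θ p s (us ++ [u]) = (algProcess θ p s us).bind fun s' => algStep θ p s' u := by
  induction us generalizing s with
  | nil => exact Proc.bind_done _
  | cons v us ih =>
    calc algProcess θ p s (v :: us ++ [u]) =
        (algStep θ p s v).bind fun s' => algProcess θ p s' (us ++ [u]) := rfl
      _ = ((algStep θ p s v).bind fun s' => algProcess θ p s' us).bind
          fun s' => algStep θ p s' u := by simp only [ih, Proc.bind_assoc]

/-- The whole algorithm, for the updates `us`. -/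
noncomputable def algRun [Fintype V] (θ : AlgParams) (p : Prediction V) (us : List (Update V)) :
    Proc V (AlgState V) :=
  (algPre θ p).bind fun s => algProcess θ p s us

theorem algRun_append [Fintype V] (θ : AlgParams) (p : Prediction V) (us : List (Update V))
    (u : Update V) :
    algRun θ p (us ++ [u]) = (algRun θ p us).bind fun s => algStep θ p s u := by
  simp only [algRun, algProcess_append, Proc.bind_assoc]

/-! ### Feasibility and the number of queries -/

/-- The list `localUpdates` for the values of the elements under `f`. -/
noncomputable def loc (f : Finset V → ℝ) (θ : AlgParams) (i : ℤ) (us : List (Update V)) :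
    List (Update V) :=
  localUpdates θ (marginal f ∅) i us

theorem loc_append (θ : AlgParams) (i : ℤ) (us : List (Update V)) (u : Update V) :
    loc f θ i (us ++ [u]) = loc f θ i us ++
      if i ∈ guesses θ.b θ.B (marginal f ∅ u.elt) then [u] else [] := by
  rw [loc, localUpdates, List.filter_append, loc, localUpdates]
  congr 1
  split_ifs with h <;> simp [h]

theorem mem_loc {θ : AlgParams} {i : ℤ} {us : List (Update V)} {u : Update V} :
    u ∈ loc f θ i us ↔ u ∈ us ∧ i ∈ guesses θ.b θ.B (marginal f ∅ u.elt) := by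
  simp [loc, localUpdates]

variable [Fintype V]

/-- The elements for which the threshold `b ^ i` is relevant. -/
noncomputable def relevant (f : Finset V → ℝ) (θ : AlgParams) (i : ℤ) : Finset V :=
  Finset.univ.filter fun a => i ∈ guesses θ.b θ.B (marginal f ∅ a)

/-- The thresholds that are relevant for some element. -/
noncomputable def allGuesses (f : Finset V → ℝ) (θ : AlgParams) : Finset ℤ :=
  Finset.univ.biUnion fun a => guesses θ.b θ.B (marginal f ∅ a)

theorem guesses_subset (f : Finset V → ℝ) (θ : AlgParams) (a : V) :
    guesses θ.b θ.B (marginal f ∅ a) ⊆ allGuesses f θ :=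
  Finset.subset_biUnion_of_mem (fun a => guesses θ.b θ.B (marginal f ∅ a)) (Finset.mem_univ a)

/-- The largest value is the value of some element, unless it is `0`. -/
theorem guesses_maxValue_subset (f : Finset V → ℝ) (θ : AlgParams) (W : Finset V) :
    guesses θ.b θ.B (maxValue (marginal f ∅) W) ⊆ allGuesses f θ := by
  rcases exists_eq_maxValue (marginal f ∅) W with h | ⟨a, -, h⟩
  · rw [h, guesses, if_neg (lt_irrefl _)]
    exact Finset.empty_subset _
  · rw [h]
    exact guesses_subset f θ a

theorem active_loc (θ : AlgParams) (i : ℤ) (us : List (Update V)) :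
    active (loc f θ i us) = active us ∩ relevant f θ i := by
  rw [← active_filter, loc, localUpdates]
  congr 1
  refine List.filter_congr fun u _ => ?_
  simp [relevant]

theorem disc_active_loc_le (θ : AlgParams) (i : ℤ) (us vs : List (Update V)) :
    disc (active (loc f θ i us)) (active (loc f θ i vs)) ≤ disc (active us) (active vs) := by
  rw [active_loc, active_loc, disc, disc]
  refine Nat.add_le_add (Finset.card_le_card ?_) (Finset.card_le_card ?_) <;>
  · intro x
    simp only [Finset.mem_sdiff, Finset.mem_inter]
    tauto

theorem AlgParams.Good.at {θ : AlgParams} (hθ : θ.Good) (f : Finset V → ℝ) (i : ℤ) :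
    (θ.at i).Good f (relevant f θ i) := by
  have hpos : 0 < θ.b ^ i := zpow_pos (by linarith [hθ.one_lt]) i
  refine ⟨hθ.fuel, hpos, fun x hx => ?_⟩
  rw [relevant, Finset.mem_filter, mem_guesses hθ.one_lt (by linarith [hθ.one_le])] at hx
  exact hx.2.2.2.trans_lt (mul_lt_mul_of_pos_right hθ.lt hpos)

theorem elt_mem_relevant {θ : AlgParams} {i : ℤ} {us : List (Update V)} :
    ∀ u ∈ loc f θ i us, u.elt ∈ relevant f θ i := fun u hu => by
  rw [relevant, Finset.mem_filter]
  exact ⟨Finset.mem_univ _, (mem_loc.1 hu).2⟩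

/-- The predicted updates up to time `t` are an initial segment also after the restriction to the
elements for which a threshold is relevant. -/
theorem loc_predUpTo (θ : AlgParams) (p : Prediction V) (i : ℤ) (t : ℕ) :
    (loc f θ i (predUpTo p t)).length ≤ (loc f θ i (allPred p)).length ∧
      (loc f θ i (allPred p)).take (loc f θ i (predUpTo p t)).length =
        loc f θ i (predUpTo p t) := by
  have h : loc f θ i (predUpTo p t) <+: loc f θ i (allPred p) :=
    (predUpTo_prefix p t).filter _
  exact ⟨h.length_le, (List.prefix_iff_eq_take.1 h).symm⟩

/-- What is always true of the state after the updates `us`. -/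
structure AlgInv (f : Finset V → ℝ) (θ : AlgParams) (p : Prediction V) (us : List (Update V))
    (s : AlgState V) : Prop where
  value : s.value = marginal f ∅
  hist : s.hist = us
  guess : ∀ i ∈ allGuesses f θ,
    GuessInv f (θ.at i) (loc f θ i (allPred p)) (loc f θ i us) (s.gs i)
  subset : s.out ⊆ active us
  card_le : s.out.card ≤ θ.k
  le_out : ∀ i ∈ guesses θ.b θ.B (maxValue (marginal f ∅) (active us)),
    f ((s.gs i).fin.G ∩ active us) ≤ f s.out

/-- The number of queries for a single entry, divided by the size of its level. -/
def AlgParams.cost (θ : AlgParams) : ℕ := (θ.p + 1) * ((θ.n + 3) * (2 * θ.p * θ.K + 7))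

/-- A bound on the number of thresholds that are relevant for an element. -/
noncomputable def AlgParams.width (θ : AlgParams) : ℕ := ⌊Real.logb θ.b θ.B⌋₊ + 1

/-- Each update is relevant for few thresholds. -/
theorem sum_length_loc_le {θ : AlgParams} (hθ : θ.Good) (us : List (Update V)) :
    ∑ i ∈ allGuesses f θ, (loc f θ i us).length ≤ us.length * θ.width := by
  induction us using List.reverseRecOn with
  | nil => simp [loc, localUpdates]
  | append_singleton us u ih =>
    have : ∀ i ∈ allGuesses f θ, (loc f θ i (us ++ [u])).length = (loc f θ i us).length +
        if i ∈ guesses θ.b θ.B (marginal f ∅ u.elt) then 1 else 0 := fun i _ => by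
      rw [loc_append, List.length_append]
      split_ifs <;> rfl
    rw [Finset.sum_congr rfl this, Finset.sum_add_distrib, List.length_append,
      List.length_singleton, add_mul, one_mul]
    refine Nat.add_le_add ih ?_
    rw [← Finset.sum_filter, Finset.sum_const, smul_eq_mul, mul_one]
    refine (Finset.card_le_card fun i hi => ?_).trans
      (card_guesses_le hθ.one_lt hθ.one_le (marginal f ∅ u.elt))
    exact (Finset.mem_filter.1 hi).2

theorem pre_runs (hf : Monotone f) (hs : IsSubmodular f) {θ : AlgParams} (hθ : θ.Good)
    (p : Prediction V) :
    (algPre θ p).Runs f (AlgInv f θ p [])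
      (Fintype.card V + 1 + (2 * Fintype.card V).size *
        (θ.cost * (2 * Fintype.card V * θ.width))) := by
  have hN : (allPred p).length ≤ 2 * Fintype.card V := length_le_of_nodup (predList_nodup p _)
  refine ((evalOn_runs _).bind (c' := (2 * Fintype.card V).size *
    (θ.cost * (2 * Fintype.card V * θ.width))) fun y hy => ?_).le (by simp)
  have hv : (fun a => y (insert a ∅) - y ∅) = marginal f ∅ := by
    funext a
    rw [hy ∅ (by simp), hy (insert a ∅) (List.mem_cons_of_mem _ (List.mem_map.2
      ⟨a, Finset.mem_toList.2 (Finset.mem_univ a), rfl⟩)), marginal]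
  have hv' : ∀ a, y (insert a ∅) - y ∅ = marginal f ∅ a := fun a => congrFun hv a
  simp only [hv']
  refine Runs.le (Runs.bind (loop_runs (Q := fun i g => i ∈ allGuesses f θ →
    GuessInv f (θ.at i) (loc f θ i (allPred p)) [] g)
    (fun i _ => (guessPre_runs hf hs (hθ.at f i) elt_mem_relevant).mono (fun g hg _ => hg) le_rfl)
    fun i hi hi' => absurd (Finset.mem_toList.2 hi') hi) (c' := 0) fun gs hgs => ?_) ?_
  · refine AlgInv.mk rfl rfl hgs (by simp) (by simp) fun i _ => ?_
    simp [active]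
  · rw [Finset.sum_map_toList, add_zero]
    refine (Finset.sum_le_sum (g := fun i => (2 * Fintype.card V).size *
      (θ.cost * (loc f θ i (allPred p)).length)) fun i _ => ?_).trans ?_
    · have : (loc f θ i (allPred p)).length ≤ 2 * Fintype.card V :=
        (List.length_filter_le _ _).trans hN
      exact Nat.mul_le_mul_right _ (Nat.size_le_size this)
    · rw [← Finset.mul_sum, ← Finset.mul_sum]
      have := sum_length_loc_le (f := f) hθ (allPred p)
      gcongr
      exact this.trans (Nat.mul_le_mul_right _ hN)

/-- A bound on the number of queries for the updates `us`. -/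
noncomputable def totalBudget (f : Finset V → ℝ) (θ : AlgParams) (H : ℕ) (us : List (Update V)) :
    ℕ :=
  ∑ i ∈ allGuesses f θ, budget (θ.at i) H (loc f θ i us).length + us.length * (θ.width + 1)

theorem totalBudget_le {θ : AlgParams} (hθ : θ.Good) (H : ℕ) (us : List (Update V)) :
    totalBudget f θ H us ≤
      us.length * (θ.cost * (H.size + 1) * θ.width + (θ.width + 1)) := by
  rw [totalBudget, mul_add us.length (θ.cost * (H.size + 1) * θ.width)]
  refine Nat.add_le_add_right ?_ _
  calc _ ≤ ∑ i ∈ allGuesses f θ, θ.cost * (H.size + 1) * (loc f θ i us).length :=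
        Finset.sum_le_sum fun i _ => budget_le _ _ _
    _ = θ.cost * (H.size + 1) * ∑ i ∈ allGuesses f θ, (loc f θ i us).length := by
        rw [Finset.mul_sum]
    _ ≤ θ.cost * (H.size + 1) * (us.length * θ.width) := by
        gcongr; exact sum_length_loc_le hθ us
    _ = _ := by ring

theorem totalBudget_append {θ : AlgParams} (H : ℕ) (us : List (Update V)) (u : Update V) :
    totalBudget f θ H (us ++ [u]) = totalBudget f θ H us +
      (∑ i ∈ guesses θ.b θ.B (marginal f ∅ u.elt), (budget (θ.at i) H ((loc f θ i us).length + 1) -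
        budget (θ.at i) H (loc f θ i us).length) + (θ.width + 1)) := by
  have hmono : ∀ i T, budget (θ.at i) H T ≤ budget (θ.at i) H (T + 1) := fun i T => by
    rw [budget_succ]; exact Nat.le_add_right _ _
  have : ∀ i ∈ allGuesses f θ, budget (θ.at i) H (loc f θ i (us ++ [u])).length =
      budget (θ.at i) H (loc f θ i us).length +
      if i ∈ guesses θ.b θ.B (marginal f ∅ u.elt) then
        budget (θ.at i) H ((loc f θ i us).length + 1) -
        budget (θ.at i) H (loc f θ i us).length else 0 := fun i _ => by
    rw [loc_append]
    split_ifs with h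
    · rw [List.length_append, List.length_singleton, Nat.add_sub_cancel' (hmono i _)]
    · simp
  rw [totalBudget, Finset.sum_congr rfl this, Finset.sum_add_distrib, ← Finset.sum_filter,
    Finset.filter_mem_eq_inter, Finset.inter_eq_right.2 (guesses_subset f θ _), totalBudget,
    List.length_append, List.length_singleton]
  ring

end Algorithm

section Analysis

open Proc

variable {V : Type} [DecidableEq V] [Fintype V] {f : Finset V → ℝ}

theorem stepGuesses_runs (hf : Monotone f) (hs : IsSubmodular f) {θ : AlgParams} (hθ : θ.Good)
    {p : Prediction V} {us : List (Update V)} {u : Update V} {H : ℕ}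
    (hH : disc (active (us ++ [u])) (active (predUpTo p (us ++ [u]).length)) ≤ H)
    {gs : ℤ → GuessState V} (hgs : ∀ i ∈ allGuesses f θ,
      GuessInv f (θ.at i) (loc f θ i (allPred p)) (loc f θ i us) (gs i)) :
    (stepGuesses θ p (marginal f ∅) us u gs).Runs f
      (fun gs' => ∀ i, i ∈ allGuesses f θ →
        GuessInv f (θ.at i) (loc f θ i (allPred p)) (loc f θ i (us ++ [u])) (gs' i))
      (∑ i ∈ guesses θ.b θ.B (marginal f ∅ u.elt), (budget (θ.at i) H ((loc f θ i us).length + 1) -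
        budget (θ.at i) H (loc f θ i us).length)) := by
  rw [← Finset.sum_map_toList]
  refine loop_runs (Q := fun i g => i ∈ allGuesses f θ →
    GuessInv f (θ.at i) (loc f θ i (allPred p)) (loc f θ i (us ++ [u])) g)
    (fun i hi => ?_) fun i hi hi' => ?_
  · rw [Finset.mem_toList] at hi
    obtain ⟨h1, h2⟩ := loc_predUpTo (f := f) θ p i (us ++ [u]).length
    have h3 : loc f θ i (us ++ [u]) = loc f θ i us ++ [u] := by rw [loc_append, if_pos hi]
    have key : (guessStep (θ.at i) (loc f θ i (allPred p)) (loc f θ i (us ++ [u]))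
        (loc f θ i (predUpTo p (us ++ [u]).length)).length (gs i)).Runs f
        (GuessInv f (θ.at i) (loc f θ i (allPred p)) (loc f θ i (us ++ [u])))
        (budget (θ.at i) H ((loc f θ i us).length + 1) -
          budget (θ.at i) H (loc f θ i us).length) := by
      have h4 := (disc_active_loc_le (f := f) θ i _ _).trans hH
      have h5 : ∀ v ∈ loc f θ i (us ++ [u]), v.elt ∈ relevant f θ i := elt_mem_relevant
      rw [← h2] at h4
      rw [h3] at h4 h5 ⊢
      exact guessStep_runs hf hs (hθ.at f i) h5 h1 h4 (hgs i (guesses_subset f θ _ hi))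
    exact key.mono (fun g hg _ => hg) le_rfl
  · rw [Finset.mem_toList] at hi
    rw [loc_append, if_neg hi, List.append_nil]
    exact hgs i hi'

theorem step_runs (hf : Monotone f) (hs : IsSubmodular f) {θ : AlgParams} (hθ : θ.Good)
    {p : Prediction V} {us : List (Update V)} {u : Update V} {H : ℕ}
    (hH : disc (active (us ++ [u])) (active (predUpTo p (us ++ [u]).length)) ≤ H)
    {s : AlgState V} (hI : AlgInv f θ p us s) :
    (algStep θ p s u).Runs f (AlgInv f θ p (us ++ [u]))
      (totalBudget f θ H (us ++ [u]) - totalBudget f θ H us) := by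
  rw [totalBudget_append, Nat.add_sub_cancel_left]
  obtain ⟨v, hist, gs₀, out⟩ := s
  obtain ⟨hv, hh, hg, -, -, -⟩ := hI
  dsimp only at hv hh hg
  subst hv hh
  refine (stepGuesses_runs hf hs hθ hH hg).bind fun gs hgs => ?_
  set L := candidates θ (marginal f ∅) (active (hist ++ [u])) gs with hL
  have hlen : (∅ :: L).length ≤ θ.width + 1 := by
    rw [hL, candidates, List.length_cons, List.length_map, Finset.length_toList]
    exact Nat.succ_le_succ (card_guesses_le hθ.one_lt hθ.one_le _)
  refine Runs.le (Runs.bind (evalOn_runs (∅ :: L)) (c' := 0) fun y hy => ?_) hlen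
  obtain ⟨h1, h2⟩ := best_spec y L
  have hout : best y L ⊆ active (hist ++ [u]) ∧ (best y L).card ≤ θ.k := by
    rcases List.mem_cons.1 h1 with h | h
    · rw [h]
      simp
    · rw [hL, candidates, List.mem_map] at h
      obtain ⟨i, hi, h⟩ := h
      change _ = best y L at h
      rw [← h]
      refine ⟨Finset.inter_subset_right, (Finset.card_le_card Finset.inter_subset_left).trans ?_⟩
      exact (hgs i (guesses_maxValue_subset f θ _ (Finset.mem_toList.1 hi))).fin.1.greedy.card_le
  refine AlgInv.mk rfl rfl hgs hout.1 hout.2 fun i hi => ?_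
  have hi' : (gs i).fin.G ∩ active (hist ++ [u]) ∈ L := by
    rw [hL, candidates, List.mem_map]
    exact ⟨i, Finset.mem_toList.2 hi, rfl⟩
  have h3 := h2 _ hi'
  rw [hy _ h1, hy _ (List.mem_cons_of_mem _ hi')] at h3
  exact h3

theorem process_runs (hf : Monotone f) (hs : IsSubmodular f) {θ : AlgParams} (hθ : θ.Good)
    {p : Prediction V} {us : List (Update V)} {H : ℕ}
    (hH : ∀ t ≤ us.length, disc (active (us.take t)) (active (predUpTo p t)) ≤ H)
    {s : AlgState V} (hI : AlgInv f θ p [] s) :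
    (algProcess θ p s us).Runs f (AlgInv f θ p us) (totalBudget f θ H us) := by
  induction us using List.reverseRecOn with
  | nil => exact hI
  | append_singleton us u ih =>
    have h1 := ih fun t ht => by
      have := hH t (by rw [List.length_append]; omega)
      rwa [List.take_append_of_le_length ht] at this
    have h2 := hH (us ++ [u]).length le_rfl
    rw [List.take_length] at h2
    rw [algProcess_append]
    refine (h1.bind fun s' hs' => step_runs hf hs hθ h2 hs').le ?_
    rw [totalBudget_append]
    omega

theorem run_always (hf : Monotone f) (hs : IsSubmodular f) {θ : AlgParams} (hθ : θ.Good)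
    (p : Prediction V) (us : List (Update V)) :
    (algRun θ p us).Always f (AlgInv f θ p us) := by
  -- any bound on the differences will do, since only the invariant is of interest
  refine ((pre_runs hf hs hθ p).bind fun s hI => process_runs hf hs hθ (H :=
    ∑ t ∈ Finset.range (us.length + 1), disc (active (us.take t)) (active (predUpTo p t)))
    (fun t ht => ?_) hI).always
  exact Finset.single_le_sum (f := fun t => disc (active (us.take t)) (active (predUpTo p t)))
    (fun _ _ => Nat.zero_le _) (Finset.mem_range.2 (by omega))

/-! ### The approximation guarantee -/

omit [Fintype V] in
theorem GuessExpect.congr {lam : ℝ} {es us : List (Update V)} {Q Q' : Proc V (GuessState V)}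
    (h : GuessExpect f lam es us Q) (hQ : ∀ F : GuessState V → ℝ, Q'.expect f F = Q.expect f F) :
    GuessExpect f lam es us Q' :=
  ⟨fun l j A hA => hQ _ ▸ h.pred l j A hA, fun l A hA => hQ _ ▸ h.stack l A hA, hQ _ ▸ h.fin⟩

/-- The component for a threshold of the state after the updates `us`. -/
noncomputable def guessRun (θ : AlgParams) (p : Prediction V) (i : ℤ) (us : List (Update V)) :
    Proc V (GuessState V) :=
  (algRun θ p us).bind fun s => done (s.gs i)

/-- The algorithms for different thresholds do not interact, so that the guarantees for a single
threshold apply to its component of the state. -/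
theorem guessRun_expect (hf : Monotone f) (hs : IsSubmodular f) {θ : AlgParams} (hθ : θ.Good)
    {lam : ℝ} (hlam : 0 ≤ lam) (hK : 8 ≤ lam * θ.K) (p : Prediction V) {i : ℤ}
    (hi : i ∈ allGuesses f θ) (us : List (Update V)) :
    GuessExpect f lam (loc f θ i (allPred p)) (loc f θ i us) (guessRun θ p i us) := by
  induction us using List.reverseRecOn with
  | nil =>
    refine (guessPre_expect hf hs (hθ.at f i) hlam hK _).congr fun F => ?_
    rw [guessRun, show algRun θ p [] = algPre θ p from bind_done _]
    rw [algPre]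
    simp only [expect_bind, expect]
    refine expect_eq_of_always (always_mono (fun y hy => ?_) (evalOn_runs _).always)
    have hv : ∀ a, y (insert a ∅) - y ∅ = marginal f ∅ a := by
      intro a
      rw [hy ∅ (by simp), hy (insert a ∅) (List.mem_cons_of_mem _ (List.mem_map.2
        ⟨a, Finset.mem_toList.2 (Finset.mem_univ a), rfl⟩)), marginal]
    simp only [hv]
    exact loop_expect_of_mem _ (Finset.nodup_toList _) (Finset.mem_toList.2 hi) F _
  | append_singleton us u ih =>
    have hrun : ∀ F : GuessState V → ℝ, (guessRun θ p i (us ++ [u])).expect f F =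
        (algRun θ p us).expect f fun s =>
          (stepGuesses θ p (marginal f ∅) us u s.gs).expect f fun gs => F (gs i) := by
      intro F
      rw [guessRun, algRun_append]
      simp only [expect_bind, expect]
      refine expect_congr (always_mono (fun s hI => ?_) (run_always hf hs hθ p us))
      simp only [algStep, expect_bind, expect, expect_const, hI.value, hI.hist]
    by_cases hu : i ∈ guesses θ.b θ.B (marginal f ∅ u.elt)
    · rw [loc_append, if_pos hu]
      refine (guessStep_expect hf hs (hθ.at f i) hlam hK
        (loc_predUpTo (f := f) θ p i (us ++ [u]).length).1 ih).congr fun F => ?_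
      rw [hrun, expect_bind, guessRun, expect_bind]
      refine expect_congr (always_of_forall fun s => ?_)
      rw [stepGuesses, loop_expect_of_mem _ (Finset.nodup_toList _) (Finset.mem_toList.2 hu) F]
      have h3 : loc f θ i (us ++ [u]) = loc f θ i us ++ [u] := by rw [loc_append, if_pos hu]
      rw [← h3]
      rfl
    · rw [loc_append, if_neg hu, List.append_nil]
      refine ih.congr fun F => ?_
      rw [hrun, guessRun, expect_bind]
      refine expect_congr (always_of_forall fun s => ?_)
      rw [stepGuesses, loop_expect_of_notMem _ (fun h => hu (Finset.mem_toList.1 h)) F]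
      rfl

end Analysis

section Approx

open Proc

variable {V : Type} [DecidableEq V] {f : Finset V → ℝ}

/-- A full solution has a large value because each of its elements contributes `τ`, and any other
solution because no element contributes much to it any more. -/
theorem le_value_of_valid (hf : Monotone f) (hs : IsSubmodular f) {k : ℕ} {τ v : ℝ}
    {b : ℝ} (hb : 1 ≤ b) (hv : 0 ≤ v) (hτ : 0 ≤ τ) (hlow : v ≤ 2 * k * (b * τ))
    (hupp : 2 * k * τ ≤ v) {e : Entry V} (he : e.Valid f k τ 0) {S : Finset V} (hS : S.card ≤ k)
    (hSv : f S = f ∅ + v) (hSW : ∀ x ∈ S, x ∈ e.W ∨ marginal f ∅ x < τ) :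
    v / (2 * b) ≤ f e.G - f ∅ := by
  rw [div_le_iff₀ (by linarith)]
  rcases he.full_or with hk | ⟨h1, h2⟩
  · have h3 := he.greedy.value
    have h4 : (k : ℝ) ≤ e.G.card := by exact_mod_cast hk
    have h5 : τ * k ≤ τ * e.G.card := by gcongr
    simp only [Finset.card_empty, Nat.cast_zero, mul_zero, add_zero] at h3
    have h6 : b * (τ * k) ≤ b * (f e.G - f ∅) := by
      gcongr
      linarith
    linarith
  · have h3 : ∀ x ∈ S, marginal f e.G x ≤ τ := fun x hx => by
      rcases hSW x hx with hx | hx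
      · refine (h1 x hx ?_).le
        rw [Finset.card_eq_zero.1 (Nat.le_zero.1 h2)]
        simp
      · exact (marginal_anti hf hs (Finset.empty_subset _) x).trans hx.le
    have h4 := le_add_sum_marginal hf hs e.G S
    have h5 : f S ≤ f (e.G ∪ S) := hf Finset.subset_union_right
    have h6 : ∑ x ∈ S, marginal f e.G x ≤ k * τ := by
      refine (Finset.sum_le_sum h3).trans ?_
      rw [Finset.sum_const, nsmul_eq_mul]
      gcongr
    have h7 : v / 2 ≤ f e.G - f ∅ := by linarith
    nlinarith

variable [Fintype V]

/-- The approximation guarantee: the solution for the right threshold is worth about half of the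
optimum before it is restricted to the active elements, loses little by the restriction in
expectation, and is one of the candidates for the maintained solution. -/
theorem approx (hf : Monotone f) (hs : IsSubmodular f) {θ : AlgParams} (hθ : θ.Good) {lam : ℝ}
    (hlam : 0 ≤ lam) (hlam1 : lam ≤ 1) (hK : 8 ≤ lam * θ.K) (p : Prediction V)
    (us : List (Update V)) :
    f ∅ + (1 - lam) * ((opt f (active us) θ.k - f ∅) / (2 * θ.b)) ≤
      (algRun θ p us).expect f fun s => f s.out := by
  have hb := hθ.one_lt
  obtain ⟨S, hS, hSo⟩ := Finset.exists_mem_eq_sup' (feasible_nonempty (active us) θ.k) f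
  change opt f (active us) θ.k = f S at hSo
  set v := opt f (active us) θ.k - f ∅ with hv
  rw [feasible, Finset.mem_filter, Finset.mem_powerset] at hS
  by_cases hv0 : v ≤ 0
  · refine le_expect_of_always (always_of_forall fun s => ?_)
    have h1 : f ∅ ≤ f s.out := hf (Finset.empty_subset _)
    have h2 : v / (2 * θ.b) ≤ 0 := div_nonpos_of_nonpos_of_nonneg hv0 (by linarith)
    nlinarith
  rw [not_le] at hv0
  have hSv : f S = f ∅ + v := by rw [hv, hSo]; ring
  set M := maxValue (marginal f ∅) (active us) with hM
  have hk : 0 < θ.k := by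
    rcases Nat.eq_zero_or_pos θ.k with h | h
    · have : S = ∅ := by rw [← Finset.card_eq_zero]; omega
      rw [this] at hSv
      linarith
    · exact h
  have hkR : (0 : ℝ) < θ.k := by exact_mod_cast hk
  -- the largest value `M` of an active element determines the optimum up to the factor `k`
  have hvM : v ≤ θ.k * M := by
    have h1 := le_add_sum_marginal hf hs ∅ S
    rw [Finset.empty_union, hSv] at h1
    have h2 : ∑ x ∈ S, marginal f ∅ x ≤ S.card * M := by
      rw [← nsmul_eq_mul]
      exact Finset.sum_le_card_nsmul _ _ _ fun x hx => le_maxValue _ (hS.1 hx)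
    have h3 : 0 ≤ M := (exists_eq_maxValue (marginal f ∅) (active us)).elim (fun h => h.ge)
      fun ⟨a, _, h⟩ => by rw [hM, h]; exact sub_nonneg.2 (hf (Finset.subset_insert _ _))
    have h4 : (S.card : ℝ) * M ≤ θ.k * M := by
      gcongr
      exact hS.2
    linarith
  have hM0 : 0 < M := by
    by_contra h
    nlinarith
  have hMv : M ≤ v := by
    rcases exists_eq_maxValue (marginal f ∅) (active us) with h | ⟨a, ha, h⟩
    · linarith
    · have : f (insert a ∅) ≤ opt f (active us) θ.k := by
        refine Finset.le_sup' (s := feasible (active us) θ.k) f ?_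
        rw [feasible, Finset.mem_filter, Finset.mem_powerset]
        refine ⟨fun x hx => ?_, by simpa using Nat.succ_le_of_lt hk⟩
        rw [insert_empty_eq, Finset.mem_singleton] at hx
        rwa [hx]
      rw [hM, h, marginal]
      linarith
  -- the threshold is the largest power of `b` that is at most `v / (2 * k)`
  set i := ⌊Real.logb θ.b (v / (2 * θ.k))⌋ with hi
  set τ := θ.b ^ i with hτ
  have hτ0 : 0 < τ := zpow_pos (by linarith) i
  have hq : 0 < v / (2 * θ.k) := by positivity
  have hupp : 2 * θ.k * τ ≤ v := by
    have h1 := Int.floor_le (Real.logb θ.b (v / (2 * θ.k)))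
    rw [Real.le_logb_iff_rpow_le hb hq, ← hi, Real.rpow_intCast,
      le_div_iff₀ (by positivity)] at h1
    linarith
  have hlow : v ≤ 2 * θ.k * (θ.b * τ) := by
    have h1 := (Int.lt_floor_add_one (Real.logb θ.b (v / (2 * θ.k)))).le
    rw [Real.logb_le_iff_le_rpow hb hq, ← hi] at h1
    have h2 : θ.b ^ ((i : ℝ) + 1) = θ.b * τ := by
      rw [Real.rpow_add (by linarith), Real.rpow_one, Real.rpow_intCast, mul_comm]
    rw [h2, div_le_iff₀ (by positivity)] at h1
    linarith
  have hkτ : θ.k * τ * 2 * θ.b ≤ θ.B * τ := by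
    have h1 := hθ.le
    have h2 := hθ.le_two
    have : θ.k * τ * 2 * θ.b ≤ θ.k * τ * 2 * 2 := by gcongr
    nlinarith
  have hMB : M ≤ θ.B * τ := by linarith
  have hmem : i ∈ guesses θ.b θ.B M := by
    refine (mem_guesses hb (by linarith [hθ.one_le]) i).2 ⟨hM0, ?_, hMB⟩
    have h1 : θ.k * (2 * τ) ≤ θ.k * M := by linarith
    have h2 := le_of_mul_le_mul_left h1 hkR
    linarith
  have hall : i ∈ allGuesses f θ := guesses_maxValue_subset f θ _ hmem
  have hfin := (guessRun_expect hf hs hθ hlam hK p hall us).fin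
  rw [guessRun, expect_bind] at hfin
  have hpath : (algRun θ p us).Always f fun s =>
      potential f lam (active (loc f θ i us)) (s.gs i).fin.G +
        (f ∅ + (1 - lam) * (v / (2 * θ.b))) ≤ f s.out := by
    refine always_mono (fun s hI => ?_) (run_always hf hs hθ p us)
    obtain ⟨h1, h2⟩ := (hI.guess i hall).fin
    have h3 := le_value_of_valid hf hs hb.le hv0.le hτ0.le hlow hupp h1 hS.2 hSv fun x hx => by
      by_cases hxi : i ∈ guesses θ.b θ.B (marginal f ∅ x)
      · left
        rw [h2, active_loc, Finset.mem_inter, relevant, Finset.mem_filter]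
        exact ⟨hS.1 hx, Finset.mem_univ _, hxi⟩
      · right
        by_contra hτx
        rw [not_lt] at hτx
        exact hxi ((mem_guesses hb (by linarith [hθ.one_le]) i).2
          ⟨by linarith, hτx, (le_maxValue _ (hS.1 hx)).trans hMB⟩)
    have h4 : f ((s.gs i).fin.G ∩ active (loc f θ i us)) ≤ f s.out := by
      refine (hf ?_).trans (hI.le_out i hmem)
      rw [active_loc]
      exact Finset.inter_subset_inter le_rfl Finset.inter_subset_left
    have h5 : (1 - lam) * (v / (2 * θ.b)) ≤ (1 - lam) * (f (s.gs i).fin.G - f ∅) := by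
      gcongr
    rw [potential]
    linarith
  refine le_trans ?_ (expect_mono hpath)
  rw [expect_add_const]
  simp only [expect] at hfin
  linarith

end Approx

/-! ### The choice of the parameters -/

section Bounds

theorem half_le_log (x : ℕ) : 1 / 2 ≤ Real.log (x + 2) := by
  have h1 := Real.log_two_gt_d9
  have h2 : Real.log 2 ≤ Real.log (x + 2) :=
    Real.log_le_log (by norm_num) (by linarith [(Nat.cast_nonneg x : (0 : ℝ) ≤ x)])
  linarith

theorem size_le_log (x : ℕ) : (x.size : ℝ) ≤ 3 * Real.log (x + 2) := by
  have h1 := Real.log_two_gt_d9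
  have hx : (0 : ℝ) ≤ x := Nat.cast_nonneg x
  have h2 : Real.log 2 ≤ Real.log (x + 2) := Real.log_le_log (by norm_num) (by linarith)
  have h3 : (x.size : ℝ) * Real.log 2 ≤ Real.log (x + 2) + Real.log 2 := by
    rw [← Real.log_pow, ← Real.log_mul (by linarith) (by norm_num)]
    refine Real.log_le_log (by positivity) ?_
    rcases Nat.eq_zero_or_pos x with rfl | hpos
    · norm_num
    · have : 2 ^ x.size ≤ x * 2 := by
        have h4 : 0 < x.size := Nat.size_pos.2 hpos
        have h5 : 2 ^ (x.size - 1) ≤ x := Nat.lt_size.1 (by omega)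
        calc 2 ^ x.size = 2 ^ (x.size - 1) * 2 := by rw [← pow_succ, Nat.sub_add_cancel h4]
          _ ≤ _ := by gcongr
      have : (2 : ℝ) ^ x.size ≤ x * 2 := by exact_mod_cast this
      linarith
  have h6 : (0 : ℝ) ≤ x.size := Nat.cast_nonneg _
  nlinarith

theorem log_four_mul_le (x : ℕ) : Real.log (4 * (x + 2)) ≤ 3 * Real.log (x + 2) := by
  have hx : (0 : ℝ) ≤ x := Nat.cast_nonneg x
  have h2 : Real.log 2 ≤ Real.log (x + 2) := Real.log_le_log (by norm_num) (by linarith)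
  rw [Real.log_mul (by norm_num) (by linarith), show (4 : ℝ) = 2 ^ 2 by norm_num, Real.log_pow]
  push_cast
  linarith

/-- The parameters for the cardinality constraint `k` and the accuracy `δ`. -/
noncomputable def params (δ : ℝ) (k : ℕ) : AlgParams where
  k := k
  n := k.size
  p := (4 * (k + 1)).size
  K := ⌈8 / δ⌉₊
  b := 1 + δ
  B := 4 * (k + 1)

theorem params_good {δ : ℝ} (hδ : 0 < δ) (hδ1 : δ ≤ 1) (k : ℕ) : (params δ k).Good where
  fuel := Nat.lt_size_self k
  one_lt := by simpa [params] using hδ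
  le_two := by simp only [params]; linarith
  one_le := by
    simp only [params]
    linarith [(Nat.cast_nonneg k : (0 : ℝ) ≤ k)]
  le := by simp only [params]; linarith
  lt := by
    simp only [params]
    exact_mod_cast Nat.lt_size_self (4 * (k + 1))

theorem params_cost_le (δ : ℝ) (k : ℕ) : ((params δ k).cost : ℝ) ≤
    99 * (18 * ⌈8 / δ⌉₊ + 14) * Real.log (k + 2) ^ 3 := by
  set l := Real.log (k + 2) with hl
  have h1 : 1 / 2 ≤ l := half_le_log k
  have h2 : (k.size : ℝ) ≤ 3 * l := size_le_log k
  have h3 : ((4 * (k + 1)).size : ℝ) ≤ 9 * l := by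
    have := size_le_log (4 * (k + 1))
    have h4 : Real.log ((4 * (k + 1) : ℕ) + 2) ≤ Real.log (4 * (k + 2)) := by
      refine Real.log_le_log (by positivity) ?_
      push_cast
      linarith
    have := log_four_mul_le k
    linarith
  simp only [AlgParams.cost, params]
  push_cast
  calc _ ≤ (9 * l + 2 * l) * ((3 * l + 6 * l) * (2 * (9 * l) * ⌈8 / δ⌉₊ + 14 * l)) := by
        gcongr <;> linarith
    _ = _ := by ring

theorem params_width_le {δ : ℝ} (hδ : 0 < δ) (k : ℕ) : ((params δ k).width : ℝ) ≤
    (3 / Real.log (1 + δ) + 2) * Real.log (k + 2) := by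
  have h1 := half_le_log k
  have hk : (0 : ℝ) ≤ k := Nat.cast_nonneg k
  have hlog : 0 < Real.log (1 + δ) := Real.log_pos (by linarith)
  have h2 : Real.log (4 * (k + 1)) ≤ 3 * Real.log (k + 2) :=
    (Real.log_le_log (by positivity) (by linarith)).trans (log_four_mul_le k)
  have h0 : 0 ≤ Real.log (4 * ((k : ℝ) + 1)) := Real.log_nonneg (by linarith)
  simp only [AlgParams.width, params, Real.logb]
  push_cast
  have h3 := Nat.floor_le (div_nonneg h0 hlog.le)
  have h4 : Real.log (4 * (k + 1)) / Real.log (1 + δ) ≤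
      3 * Real.log (k + 2) / Real.log (1 + δ) := by gcongr
  rw [add_mul, div_mul_eq_mul_div]
  linarith

end Bounds


open Proc

section Parameters

theorem pre_bound {δ : ℝ} (hδ : 0 < δ) {m k : ℕ} (hk : k ≤ m) :
    ((m + 1 + (2 * m).size * ((params δ k).cost * (2 * m * (params δ k).width)) : ℕ) : ℝ) ≤
      (32 + 12 * (99 * (18 * ⌈8 / δ⌉₊ + 14)) * (3 / Real.log (1 + δ) + 2)) * (m + 1) *
        Real.log (m + 2) ^ 5 := by
  set a : ℝ := 99 * (18 * ⌈8 / δ⌉₊ + 14)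
  set b : ℝ := 3 / Real.log (1 + δ) + 2
  have ha : 0 ≤ a := by positivity
  have hb : 0 ≤ b := by
    have := Real.log_pos (by linarith : 1 < 1 + δ)
    positivity
  have hm : (0 : ℝ) ≤ m := Nat.cast_nonneg m
  set L := Real.log (m + 2) with hL
  have hL1 : 1 / 2 ≤ L := half_le_log m
  have hk0 : 0 ≤ Real.log ((k : ℝ) + 2) := by linarith [half_le_log k]
  have hkL : Real.log (k + 2) ≤ L := Real.log_le_log (by positivity)
    (by have : (k : ℝ) ≤ m := by exact_mod_cast hk
        linarith)
  have hcost : ((params δ k).cost : ℝ) ≤ a * L ^ 3 := (params_cost_le δ k).trans (by gcongr)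
  have hwidth : ((params δ k).width : ℝ) ≤ b * L := (params_width_le hδ k).trans (by gcongr)
  have hsize : ((2 * m).size : ℝ) ≤ 6 * L := by
    have h1 := size_le_log (2 * m)
    have h2 : Real.log ((2 * m : ℕ) + 2) ≤ 2 * L := by
      rw [hL, show 2 * Real.log ((m : ℝ) + 2) = Real.log ((m + 2) ^ 2) by rw [Real.log_pow]; norm_num]
      refine Real.log_le_log (by positivity) ?_
      push_cast
      nlinarith
    linarith
  have h32 : 1 ≤ 32 * L ^ 5 := by
    have : (1 / 2 : ℝ) ^ 5 ≤ L ^ 5 := by gcongr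
    linarith
  push_cast
  calc _ ≤ ((m : ℝ) + 1) * (32 * L ^ 5) + 6 * L * (a * L ^ 3 * (2 * (m + 1) * (b * L))) := by
        gcongr ?_ + ?_ * (?_ * (2 * ?_ * ?_))
        · exact le_mul_of_one_le_right (by linarith) h32
        · linarith
    _ = _ := by ring

theorem update_bound {δ : ℝ} (hδ : 0 < δ) {k' k : ℕ} (hk : k' ≤ k) (η w : ℕ) :
    (((params δ k').cost * ((η + (2 * w + 1)).size + 1) * (params δ k').width +
      ((params δ k').width + 1) : ℕ) : ℝ) ≤
      (3 * (99 * (18 * ⌈8 / δ⌉₊ + 14)) * (3 / Real.log (1 + δ) + 2) +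
        (3 / Real.log (1 + δ) + 2) + 1) *
        (Real.log (η + 2) + Real.log (w + 2) + Real.log (k + 2)) ^ 5 := by
  set a : ℝ := 99 * (18 * ⌈8 / δ⌉₊ + 14)
  set b : ℝ := 3 / Real.log (1 + δ) + 2
  have ha : 0 ≤ a := by positivity
  have hb : 0 ≤ b := by
    have := Real.log_pos (by linarith : 1 < 1 + δ)
    positivity
  have hη : (0 : ℝ) ≤ η := Nat.cast_nonneg η
  have hw : (0 : ℝ) ≤ w := Nat.cast_nonneg w
  have h1 := half_le_log η
  have h2 := half_le_log w
  have h3 := half_le_log k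
  have hk0 : 0 ≤ Real.log ((k' : ℝ) + 2) := by linarith [half_le_log k']
  set X := Real.log (η + 2) + Real.log (w + 2) + Real.log (k + 2) with hX
  have hX1 : 1 ≤ X := by linarith
  have hkX : Real.log (k' + 2) ≤ Real.log (k + 2) := Real.log_le_log (by positivity)
    (by have : (k' : ℝ) ≤ k := by exact_mod_cast hk
        linarith)
  have hkX' : Real.log (k' + 2) ≤ X := by linarith
  have hcost : ((params δ k').cost : ℝ) ≤ a * X ^ 3 := (params_cost_le δ k').trans (by gcongr)
  have hwidth : ((params δ k').width : ℝ) ≤ b * X := (params_width_le hδ k').trans (by gcongr)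
  have hsize : ((η + (2 * w + 1)).size : ℝ) + 1 ≤ 3 * X := by
    have h4 := size_le_log (η + (2 * w + 1))
    have h5 : Real.log ((η + (2 * w + 1) : ℕ) + 2) ≤ Real.log (η + 2) + Real.log (w + 2) := by
      rw [← Real.log_mul (by linarith) (by linarith)]
      refine Real.log_le_log (by positivity) ?_
      push_cast
      nlinarith [mul_nonneg hη hw]
    linarith
  have hX5 : X ≤ X ^ 5 := le_self_pow₀ hX1 (by norm_num)
  have hX5' : 1 ≤ X ^ 5 := one_le_pow₀ hX1
  push_cast
  calc _ ≤ a * X ^ 3 * (3 * X) * (b * X) + (b * X ^ 5 + X ^ 5) := by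
        gcongr ?_ * ?_ * ?_ + (?_ + ?_)
        · exact hwidth.trans (by gcongr)
    _ = _ := by ring

/-- A constraint of more than `m` elements is no constraint; replacing `k` by `min k m` makes the
preprocessing time independent of `k`. -/
theorem opt_min {m : ℕ} (f : Finset (Fin m) → ℝ) (W : Finset (Fin m)) (k : ℕ) :
    opt f W (min k m) = opt f W k := by
  have : feasible W (min k m) = feasible W k := by
    refine Finset.filter_congr fun S _ => ?_
    have := S.card_le_univ
    rw [Fintype.card_fin] at this
    omega
  simp only [opt, this]

end Parameters

end DynSubmod

theorem mainTheorem1 :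
    ∃ c : ℕ, ∀ ε : ℝ, 0 < ε → ∃ C : ℝ,
      ∃ A : (m k w : ℕ) → DynSubmod.Prediction (Fin m) → DynSubmod.DynAlg (Fin m),
        ∀ (m k w : ℕ) (p : DynSubmod.Prediction (Fin m)) (f : Finset (Fin m) → ℝ),
          Monotone f → DynSubmod.IsSubmodular f → 0 ≤ f ∅ →
            -- the expected number of queries of the preprocessing phase is near-linear
            (A m k w p).pre.expectedQueries f ≤ C * (m + 1) * Real.log (m + 2) ^ c ∧
            ∀ us : List (DynSubmod.Update (Fin m)), DynSubmod.IsStream us →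
              -- amortized update time
              (A m k w p).expectedUpdateQueries f us ≤
                us.length * (C * (Real.log (DynSubmod.predictionError w p us + 2)
                  + Real.log (w + 2) + Real.log (k + 2)) ^ c) ∧
              -- at every time step, feasibility and approximation in expectation
              ∀ t ≤ us.length,
                ((A m k w p).run (us.take t)).Always f (fun s =>
                  (A m k w p).sol s ⊆ DynSubmod.active (us.take t) ∧
                    ((A m k w p).sol s).card ≤ k) ∧
                (1 / 2 - ε) * DynSubmod.opt f (DynSubmod.active (us.take t)) k ≤
                  ((A m k w p).run (us.take t)).expect f (fun s => f ((A m k w p).sol s)) := by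
  open DynSubmod in
  refine ⟨5, fun ε hε => ?_⟩
  obtain ⟨δ, hδ, hδ1, hδε⟩ : ∃ δ : ℝ, 0 < δ ∧ δ ≤ 1 ∧ δ ≤ ε :=
    ⟨min ε 1, by positivity, min_le_right _ _, min_le_left _ _⟩
  set a : ℝ := 99 * (18 * ⌈8 / δ⌉₊ + 14) with ha
  set b : ℝ := 3 / Real.log (1 + δ) + 2 with hb
  have ha0 : 0 ≤ a := by positivity
  have hb0 : 0 ≤ b := by
    have := Real.log_pos (by linarith : 1 < 1 + δ)
    positivity
  have hab : 0 ≤ a * b := mul_nonneg ha0 hb0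
  refine ⟨32 + 12 * a * b + b, fun m k w p => alg (params δ (min k m)) p,
    fun m k w p f hf hs h0 => ?_⟩
  have hθ := params_good hδ hδ1 (min k m)
  have hm : (0 : ℝ) ≤ m := Nat.cast_nonneg m
  have hpre := pre_runs hf hs hθ p
  refine ⟨?_, fun us hus => ⟨?_, fun t _ => ⟨?_, ?_⟩⟩⟩
  · refine hpre.expectedQueries_le.trans ?_
    rw [Fintype.card_fin]
    refine (pre_bound hδ (min_le_right k m)).trans ?_
    have : 0 ≤ Real.log ((m : ℝ) + 2) := by linarith [half_le_log m]
    have hC : 32 + 12 * a * b ≤ 32 + 12 * a * b + b := by linarith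
    exact mul_le_mul_of_nonneg_right (mul_le_mul_of_nonneg_right hC (by positivity))
      (by positivity)
  · have hproc : ∀ s, AlgInv f (params δ (min k m)) p [] s →
        (algProcess (params δ (min k m)) p s us).expectedQueries f ≤
          us.length * ((32 + 12 * a * b + b) * (Real.log (predictionError w p us + 2)
            + Real.log (w + 2) + Real.log (k + 2)) ^ 5) := by
      intro s hI
      refine (process_runs hf hs hθ (fun t _ => disc_active_le w p hus t)
        hI).expectedQueries_le.trans ?_
      refine (Nat.cast_le.2 (totalBudget_le hθ _ us)).trans ?_
      rw [Nat.cast_mul]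
      have hX : 0 ≤ Real.log ((predictionError w p us : ℝ) + 2) + Real.log ((w : ℝ) + 2)
          + Real.log ((k : ℝ) + 2) := by
        linarith [half_le_log (predictionError w p us), half_le_log w, half_le_log k]
      have hC : 3 * a * b + b + 1 ≤ 32 + 12 * a * b + b := by linarith
      exact mul_le_mul_of_nonneg_left ((update_bound hδ (min_le_left k m) _ w).trans
        (mul_le_mul_of_nonneg_right hC (by positivity))) (by positivity)
    exact (Proc.expect_mono (Proc.always_mono hproc hpre.always)).trans
      (Proc.expect_const _ _).le
  · exact Proc.always_mono (fun s hI => ⟨hI.subset, hI.card_le.trans (min_le_left k m)⟩)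
      (run_always hf hs hθ p (us.take t))
  · have hK : 8 ≤ δ * (params δ (min k m)).K := by
      have := Nat.le_ceil (8 / δ)
      rw [div_le_iff₀ hδ] at this
      simp only [params]
      linarith
    refine le_trans ?_ (approx hf hs hθ hδ.le hδ1 hK p (us.take t))
    have hopt : opt f (active (us.take t)) (params δ (min k m)).k =
        opt f (active (us.take t)) k := opt_min f _ k
    rw [hopt]
    have hO : f ∅ ≤ opt f (active (us.take t)) k :=
      Finset.le_sup' (s := feasible (active (us.take t)) k) f (by simp [feasible])
    generalize opt f (active (us.take t)) k = O at *
    change _ ≤ f ∅ + (1 - δ) * ((O - f ∅) / (2 * (1 + δ)))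
    have h1 : (1 / 2 - δ) * (O - f ∅) ≤ (1 - δ) * ((O - f ∅) / (2 * (1 + δ))) := by
      rw [mul_div_assoc', le_div_iff₀ (by linarith)]
      nlinarith [mul_nonneg (sub_nonneg.2 hO) (sq_nonneg δ)]
    nlinarith
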